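/- Let $(\Omega,\mathcal B)$ be a measurable space. A $\sigma$-finite signed measure on $(\Omega,\mathcal B)$ is an extended real valued countably additive set function on $\mathcal B$, vanishing at $\emptyset$ and taking at most one of the values $+\infty$, $-\infty$, whose total variation is $\sigma$-finite. For such a $\mu$, an atom of $\mu$ is a set $A\in\mathcal B$ with $|\mu|(A)>0$ such that every measurable $B\subset A$ satisfies $|\mu|(B)=0$ or $|\mu|(A\setminus B)=0$. A signed measure $\nu$ on $(\Omega,\mathcal B)$ satisfies $(\mathcal L)$ with respect to $\mu$ if for all $A,B\in\mathcal B$ with $\mu(A)=\mu(B)\neq\pm\infty$ one has $\nu(A)=\nu(B)\neq\pm\infty$. Theorem 3.5. Let $\mu$ be a $\sigma$-finite signed measure on $(\Omega,\mathcal B)$ whose range $\{\mu(A):A\in\mathcal B\}$ is an interval of extended real numbers, and let $\nu$ be a $\sigma$-finite signed measure on $(\Omega,\mathcal B)$ satisfying $(\mathcal L)$ with respect to $\mu$. Suppose that there exist $\varepsilon>0$ and $M<\infty$ such that $\left|\frac{\nu(A)}{\mu(A)}\right|<M$ for every atom $A$ of $\mu$ with $|\mu(A)|<\varepsilon$ (in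 particular, it suffices that this holds for every atom $A$ with $\mu(A)<\varepsilon$). Then $\nu$ is a multiple of $\mu$: there is $\alpha\in\mathbb R$ with $\nu(A)=\alpha\,\mu(A)$ for all $A\in\mathcal B$, where $0\cdot(\pm\infty)=0$. -/

import Mathlib

namespace LevelSets

open MeasureTheory

theorem abs_eq_max (x : EReal) : x.abs = max x.toENNReal (-x).toENNReal := by
  induction x with
  | bot => simp
  | top => simp
  | coe x =>
    rw [EReal.abs_def, ← EReal.coe_neg, EReal.toENNReal_of_ne_top (EReal.coe_ne_top _),
      EReal.toENNReal_of_ne_top (EReal.coe_ne_top _), EReal.toReal_coe, EReal.toReal_coe,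
      abs_eq_max_neg, ENNReal.ofReal_max]

theorem continuous_abs : Continuous EReal.abs := by
  have h : EReal.abs = fun x : EReal => max x.toENNReal (-x).toENNReal := funext abs_eq_max
  rw [h]
  exact EReal.continuous_toENNReal.max (EReal.continuous_toENNReal.comp continuous_neg)

theorem abs_add_le (x y : EReal) : (x + y).abs ≤ x.abs + y.abs := by
  induction x with
  | bot => simp
  | top => simp
  | coe x =>
    induction y with
    | bot => simp
    | top => simp
    | coe y =>
      rw [← EReal.coe_add, EReal.abs_def, EReal.abs_def, EReal.abs_def,
        ← ENNReal.ofReal_add (abs_nonneg x) (abs_nonneg y)]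
      exact ENNReal.ofReal_le_ofReal (_root_.abs_add_le x y)

theorem isSigmaSubadditive_abs {Ω : Type*} [MeasurableSpace Ω] (μ : VectorMeasure Ω EReal) :
    IsSigmaSubadditiveSetFun (fun A => (μ A).abs) := by
  intro s hs
  have h : HasSum (fun i => μ (s i).val) (μ (⋃ i, (s i).val)) :=
    μ.m_iUnion (fun i => (s i).prop) hs
  have h' := (continuous_abs.tendsto _).comp h
  refine le_of_tendsto h' (Filter.Eventually.of_forall fun F => ?_)
  refine le_trans ?_ (ENNReal.sum_le_tsum F)
  exact Finset.le_sum_of_subadditive EReal.abs (by simp) abs_add_le F _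

/-- The total variation `|μ|` of an extended real valued measure `μ`, as a positive measure:
`|μ|(A)` is the supremum of `∑ |μ(Aᵢ)|` over all finite measurable partitions `(Aᵢ)` of `A`. -/
noncomputable def variation {Ω : Type*} [MeasurableSpace Ω] (μ : VectorMeasure Ω EReal) :
    Measure Ω :=
  preVariation (fun A => (μ A).abs) (isSigmaSubadditive_abs μ) (by simp)

/-- A `σ`-finite signed measure: an extended real valued countably additive set function which
takes at most one of the values `+∞` and `-∞` and whose total variation is `σ`-finite. -/
def IsSigmaFiniteSignedMeasure {Ω : Type*} [MeasurableSpace Ω] (μ : VectorMeasure Ω EReal) :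
    Prop :=
  ((∀ A, μ A ≠ ⊤) ∨ (∀ A, μ A ≠ ⊥)) ∧ SigmaFinite (variation μ)

/-- The range `{μ(A) : A measurable}`, a set of extended real numbers. -/
def measureRange {Ω : Type*} [MeasurableSpace Ω] (μ : VectorMeasure Ω EReal) : Set EReal :=
  {x | ∃ A, MeasurableSet A ∧ μ A = x}

/-- `A` is an atom of `μ`: a measurable set which is not `|μ|`-null and each of whose measurable
subsets is `|μ|`-null or has a `|μ|`-null complement in `A`. -/
def IsAtomOf {Ω : Type*} [MeasurableSpace Ω] (μ : VectorMeasure Ω EReal) (A : Set Ω) : Prop :=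
  MeasurableSet A ∧ variation μ A ≠ 0 ∧
    ∀ B, MeasurableSet B → B ⊆ A → variation μ B = 0 ∨ variation μ (A \ B) = 0

/-- Condition `(L)` for `ν` with respect to `μ`: whenever `μ(A) = μ(B) ≠ ±∞`, also
`ν(A) = ν(B) ≠ ±∞`. -/
def SatisfiesL {Ω : Type*} [MeasurableSpace Ω] (μ ν : VectorMeasure Ω EReal) : Prop :=
  ∀ A B, MeasurableSet A → MeasurableSet B → μ A = μ B → μ A ≠ ⊤ → μ A ≠ ⊥ →
    ν A = ν B ∧ ν A ≠ ⊤ ∧ ν A ≠ ⊥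

end LevelSets

open MeasureTheory Filter Topology Set
open scoped ENNReal

/-! Let `m` be the total variation of `μ`. Since `μ` omits one infinite value, one side `Q` of its
Hahn decomposition has finite variation, and `A ↦ A ∆ Q` turns `μ` into `μ Q ± m A`
(`apply_symmDiff`). Hence `m` also has an interval as its range, and (L) says that the
correspondingly modified `ν` is `f (m A)` for a single function `f : ℝ → ℝ` (`exists_function`),
which is countably additive along disjoint sets of finite measure. It remains to show that such an
`f` is linear on the finite values of `m` (`IsAdditiveAlong.exists_linear`); σ-finiteness then
passes the identity to all sets.

Linearity near `0`. Suppose there are disjoint sets, none larger than the union of the later ones.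
Their subsums fill an interval, and at arbitrarily small scales `t` this interval is covered by
finitely many windows on which `f` increases as it does on `[0, t]`. If `|f x| ≤ M x` along the
sequence, comparing the optimal upper slope of `f` with the slopes `f t / t` forces linearity
(`TranslationCover.linear`). Such a sequence always exists. If small sets abound outside every set
of measure below some `T` (`IsFineBelow`), sets of measures `τ/2, τ/4, …` can be cut out, and `f`
has constant quotients along them. Otherwise every nonnull set of finite measure contains an atom,
and successively largest small atoms serve; the tail condition comes from the range being an
interval, the bound on the quotients from the hypothesis on atoms (`exists_linear_of_coarse`).

From near `0` to everywhere. After subtracting a linear function, `f` vanishes near `0`. Let `s` be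
the supremum of the levels up to which it vanishes. If `s` were exceeded by a set on which `f ≠ 0`,
atoms of measure slightly above or equal to `s` would carry nonzero values of `f`, and additivity
would contradict this (`IsAdditiveAlong.eq_zero_of_near_zero`). -/

namespace LevelSets

/-! ### Functions that repeat their increments on windows of small length. -/

/-- Windows `[s, s + t]`, for `s` in the finite set `S`, cover `[0, T]`, and on each of them the
increments of `f` are those of `f` on `[0, t]`. -/
structure TranslationCover (f : ℝ → ℝ) (T t : ℝ) (S : Finset ℝ) : Prop where
  pos : 0 < t
  start_nonneg : ∀ s ∈ S, 0 ≤ s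
  end_le : ∀ s ∈ S, s + t ≤ T
  cover : ∀ x, 0 ≤ x → x ≤ T → ∃ s ∈ S, s ≤ x ∧ x ≤ s + t
  add : ∀ s ∈ S, ∀ z, 0 ≤ z → z ≤ t → f (s + z) = f s + f z

namespace TranslationCover

variable {f : ℝ → ℝ} {T t L M : ℝ} {S : Finset ℝ}

theorem neg (h : TranslationCover f T t S) : TranslationCover (fun x => -f x) T t S where
  pos := h.pos
  start_nonneg := h.start_nonneg
  end_le := h.end_le
  cover := h.cover
  add s hs z h0 hz := by rw [h.add s hs z h0 hz]; ring

/-- The largest start `r` below `s'` works: if its window ended before `s'`, a window covering the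
midpoint of the gap would start strictly between `r` and `s'`. -/
theorem exists_prev (h : TranslationCover f T t S) {s s' : ℝ} (hs : s ∈ S) (hs' : s' ∈ S)
    (hlt : s < s') : ∃ r ∈ S, s ≤ r ∧ r < s' ∧ s' ≤ r + t := by
  have hne : (S.filter (· < s')).Nonempty := ⟨s, by simp [hs, hlt]⟩
  obtain ⟨r, hr, hmax⟩ := (S.filter (· < s')).exists_max_image id hne
  simp only [Finset.mem_filter, id] at hr hmax
  refine ⟨r, hr.1, hmax s ⟨hs, hlt⟩, hr.2, ?_⟩
  by_contra hcon
  push Not at hcon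
  obtain ⟨q, hq, h1, h2⟩ := h.cover ((r + t + s') / 2)
    (by linarith [h.start_nonneg r hr.1, h.pos]) (by linarith [h.end_le s' hs', h.pos])
  have := hmax q ⟨hq, by linarith⟩
  linarith

/-- One moves from `s'` back to `s` through overlapping windows, by induction on the number of
starts below `s'`; each step costs at most slope `L`. -/
theorem sub_le_of_mem (h : TranslationCover f T t S) (hL : ∀ z, 0 ≤ z → z ≤ t → f z ≤ L * z)
    {s s' : ℝ} (hs : s ∈ S) (hs' : s' ∈ S) (hle : s ≤ s') : f s' - f s ≤ L * (s' - s) := by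
  have key : ∀ n : ℕ, ∀ s' ∈ S, s ≤ s' → (S.filter (· < s')).card ≤ n →
      f s' - f s ≤ L * (s' - s) := by
    intro n
    induction n with
    | zero =>
      intro s' hs' hle hc
      rcases hle.eq_or_lt with rfl | hlt
      · simp
      · have : s ∈ S.filter (· < s') := by simp [hs, hlt]
        rw [Nat.le_zero, Finset.card_eq_zero] at hc
        simp [hc] at this
    | succ n ih =>
      intro s' hs' hle hc
      rcases hle.eq_or_lt with rfl | hlt
      · simp
      obtain ⟨r, hr, h1, h2, h3⟩ := h.exists_prev hs hs' hlt
      have hcard : (S.filter (· < r)).card < (S.filter (· < s')).card := by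
        apply Finset.card_lt_card
        rw [Finset.ssubset_iff_of_subset]
        · exact ⟨r, by simp [hr, h2], by simp⟩
        · intro x hx
          simp only [Finset.mem_filter] at hx ⊢
          exact ⟨hx.1, hx.2.trans h2⟩
      have h4 := ih r hr h1 (by omega)
      have h5 := h.add r hr (s' - r) (by linarith) (by linarith)
      have h6 := hL (s' - r) (by linarith) (by linarith)
      rw [add_sub_cancel] at h5
      rw [h5]
      linarith
  exact key _ s' hs' hle le_rfl

/-- A slope bound at the origin becomes a slope bound everywhere. The error pays for replacing `x`
by the start of its window, and vanishes as `t → 0`. -/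
theorem sub_le (h : TranslationCover f T t S) (hL : ∀ z, 0 ≤ z → z ≤ t → f z ≤ L * z)
    (hM : ∀ z, 0 ≤ z → z ≤ t → |f z| ≤ M * z)
    {x y : ℝ} (hx : 0 ≤ x) (hxy : x ≤ y) (hy : y ≤ T) :
    f y - f x ≤ L * (y - x) + (|L| + M) * t := by
  have key : ∀ s ∈ S, ∀ s' ∈ S, s ≤ s' → s ≤ x → x ≤ s + t → s' ≤ y → y ≤ s' + t →
      f y - f x ≤ L * (y - x) + (|L| + M) * t := by
    intro s hs s' hs' hss h1 h2 h3 h4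
    have e1 := h.add s hs (x - s) (by linarith) (by linarith)
    have e2 := h.add s' hs' (y - s') (by linarith) (by linarith)
    rw [add_sub_cancel] at e1 e2
    have e3 := h.sub_le_of_mem hL hs hs' hss
    have e4 := hL (y - s') (by linarith) (by linarith)
    have e5 := hM (x - s) (by linarith) (by linarith)
    have e6 := neg_le_of_abs_le e5
    have hM0 : 0 ≤ M := by
      have := (abs_nonneg _).trans (hM t h.pos.le le_rfl)
      exact nonneg_of_mul_nonneg_left this h.pos
    have e7 : M * (x - s) ≤ M * t := by gcongr; linarith
    have e8 : L * (x - s) ≤ |L| * t := by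
      calc L * (x - s) ≤ |L| * (x - s) :=
          mul_le_mul_of_nonneg_right (le_abs_self L) (by linarith)
        _ ≤ |L| * t := by gcongr; linarith
    rw [e1, e2]
    linarith
  obtain ⟨s, hs, h1, h2⟩ := h.cover x hx (hxy.trans hy)
  obtain ⟨s', hs', h3, h4⟩ := h.cover y (hx.trans hxy) hy
  rcases le_total s s' with hss | hss
  · exact key s hs s' hs' hss h1 h2 h3 h4
  -- If the window of `y` starts first, it contains `x` as well and serves for both points.
  · exact key s' hs' s' hs' le_rfl (by linarith) (by linarith) h3 h4

theorem lipschitz_above {t : ℕ → ℝ} {S : ℕ → Finset ℝ}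
    (h : ∀ n, TranslationCover f T (t n) (S n)) (ht : Tendsto t atTop (𝓝 0))
    (hL : ∀ z, 0 ≤ z → z ≤ T → f z ≤ L * z) (hM : ∀ z, 0 ≤ z → z ≤ T → |f z| ≤ M * z)
    (htT : ∀ n, t n ≤ T) {x y : ℝ} (hx : 0 ≤ x) (hxy : x ≤ y) (hy : y ≤ T) :
    f y - f x ≤ L * (y - x) := by
  have h1 : Tendsto (fun n => L * (y - x) + (|L| + M) * t n) atTop
      (𝓝 (L * (y - x) + (|L| + M) * 0)) := (ht.const_mul _).const_add _
  rw [mul_zero, add_zero] at h1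
  refine ge_of_tendsto' h1 fun n => ?_
  exact (h n).sub_le (fun z h0 hz => hL z h0 (hz.trans (htT n)))
    (fun z h0 hz => hM z h0 (hz.trans (htT n))) hx hxy hy

/-- In a block of length `2 * t` the window covering the midpoint lies inside the block. There `f`
grows by exactly `f t`, and on the remaining length `t` by at most `L * t`. -/
theorem le_blocks (h : TranslationCover f T t S)
    (hlip : ∀ x y, 0 ≤ x → x ≤ y → y ≤ T → f y - f x ≤ L * (y - x)) (h0 : f 0 = 0)
    (k : ℕ) (hk : 2 * k * t ≤ T) : f (2 * k * t) ≤ k * (f t + L * t) := by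
  induction k with
  | zero => simp [h0]
  | succ k ih =>
    have hp := h.pos
    push_cast at hk ⊢
    have hkt : 0 ≤ (k : ℝ) * t := by positivity
    obtain ⟨s, hs, h1, h2⟩ := h.cover (2 * k * t + t) (by linarith) (by linarith)
    have e0 := ih (by linarith)
    have e1 := hlip (2 * k * t) s (by linarith) (by linarith) (by linarith)
    have e2 := h.add s hs t hp.le le_rfl
    have e3 := hlip (s + t) (2 * (k + 1) * t) (by linarith) (by linarith) (by linarith)
    linarith

theorem le_half (h : TranslationCover f T t S)
    (hlip : ∀ x y, 0 ≤ x → x ≤ y → y ≤ T → f y - f x ≤ L * (y - x)) (h0 : f 0 = 0)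
    (hM : ∀ z, 0 ≤ z → z ≤ T → |f z| ≤ M * z) (htT : t ≤ T)
    {x : ℝ} (hx : 0 ≤ x) (hxT : x ≤ T) :
    f x ≤ (L + f t / t) / 2 * x + (3 * |L| + M) * t := by
  have hp := h.pos
  set k := ⌊x / (2 * t)⌋₊ with hk
  have h1 : (k : ℝ) ≤ x / (2 * t) := Nat.floor_le (by positivity)
  have h2 : x / (2 * t) < k + 1 := Nat.lt_floor_add_one _
  rw [le_div_iff₀ (by positivity)] at h1
  rw [div_lt_iff₀ (by positivity)] at h2
  have hkt : 0 ≤ (k : ℝ) * t := by positivity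
  have e1 := h.le_blocks hlip h0 k (by linarith)
  have e2 := hlip (2 * k * t) x (by linarith) (by linarith) hxT
  have hβ : |f t / t| ≤ M := by
    rw [abs_div, abs_of_pos hp, div_le_iff₀ hp]
    exact hM t hp.le htT
  set β := f t / t with hβd
  have hft : f t = β * t := by rw [hβd]; field_simp
  rw [hft] at e1
  have e3 : (L - β) / 2 * (x - 2 * k * t) ≤ (|L| + M) / 2 * (2 * t) := by
    calc (L - β) / 2 * (x - 2 * k * t) ≤ (|L| + M) / 2 * (x - 2 * k * t) := by
          refine mul_le_mul_of_nonneg_right ?_ (by linarith)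
          linarith [neg_le_of_abs_le hβ, le_abs_self L]
      _ ≤ (|L| + M) / 2 * (2 * t) := by
          have : 0 ≤ M := (abs_nonneg _).trans hβ
          gcongr
          linarith
  have e4 : 0 ≤ |L| * t := by positivity
  nlinarith

/-- If `L` is the least admissible upper slope, `le_half` shows in the limit that `(L + β) / 2` is
admissible too, whence `L ≤ β`. -/
theorem le_of_tendsto_div {t : ℕ → ℝ} {S : ℕ → Finset ℝ} {β : ℝ} (hT : 0 < T)
    (h : ∀ n, TranslationCover f T (t n) (S n)) (ht : Tendsto t atTop (𝓝 0))
    (hM : ∀ z, 0 ≤ z → z ≤ T → |f z| ≤ M * z) (htT : ∀ n, t n ≤ T)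
    (hβ : Tendsto (fun n => f (t n) / t n) atTop (𝓝 β)) {x : ℝ} (hx : 0 ≤ x) (hxT : x ≤ T) :
    f x ≤ β * x := by
  have h0 : f 0 = 0 := by
    have := hM 0 le_rfl hT.le
    simpa using this
  set Λ : Set ℝ := {L | ∀ z, 0 ≤ z → z ≤ T → f z ≤ L * z} with hΛ
  have hne : Λ.Nonempty := ⟨M, fun z hz hzT => (le_abs_self _).trans (hM z hz hzT)⟩
  have hbdd : BddBelow Λ := ⟨f T / T, fun L hL => by
    rw [div_le_iff₀ hT]; exact hL T hT.le le_rfl⟩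
  have hclosed : IsClosed Λ := by
    have : Λ = ⋂ z, {L | 0 ≤ z → z ≤ T → f z ≤ L * z} := by ext; simp [hΛ]
    rw [this]
    refine isClosed_iInter fun z => ?_
    by_cases h1 : 0 ≤ z ∧ z ≤ T
    · simp only [h1.1, h1.2, true_imp_iff]
      exact isClosed_le (by fun_prop) (by fun_prop)
    · have : {L : ℝ | 0 ≤ z → z ≤ T → f z ≤ L * z} = univ := by
        ext L
        simp only [mem_ofPred_eq, mem_univ, iff_true]
        exact fun a b => absurd ⟨a, b⟩ h1
      rw [this]; exact isClosed_univ
  have hmem : sInf Λ ∈ Λ := hclosed.csInf_mem hne hbdd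
  set L := sInf Λ with hLdef
  have hhalf : (L + β) / 2 ∈ Λ := by
    intro z hz hzT
    have h1 : Tendsto (fun n => (L + f (t n) / t n) / 2 * z + (3 * |L| + M) * t n) atTop
        (𝓝 ((L + β) / 2 * z + (3 * |L| + M) * 0)) :=
      (((hβ.const_add L).div_const 2).mul_const z).add (ht.const_mul _)
    rw [mul_zero, add_zero] at h1
    refine ge_of_tendsto' h1 fun n => ?_
    exact (h n).le_half (fun x y hx hxy hy => lipschitz_above h ht hmem hM htT hx hxy hy)
      h0 hM (htT n) hz hzT
  have hle : L ≤ β := by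
    have := csInf_le hbdd hhalf
    linarith
  exact (hmem x hx hxT).trans (by gcongr)

/-- A function with translation covers at arbitrarily small scales and with bounded difference
quotients at `0` is linear. -/
theorem linear {t : ℕ → ℝ} {S : ℕ → Finset ℝ} (hT : 0 < T)
    (h : ∀ n, TranslationCover f T (t n) (S n)) (ht : Tendsto t atTop (𝓝 0))
    (hM : ∀ z, 0 ≤ z → z ≤ T → |f z| ≤ M * z) (htT : ∀ n, t n ≤ T) :
    ∃ α : ℝ, ∀ x, 0 ≤ x → x ≤ T → f x = α * x := by
  have hbd : ∀ n, f (t n) / t n ∈ Icc (-M) M := by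
    intro n
    rw [mem_Icc, ← abs_le, abs_div, abs_of_pos (h n).pos, div_le_iff₀ (h n).pos]
    exact hM _ (h n).pos.le (htT n)
  -- The same limit slope `β` bounds `f` from above and, applied to `-f`, from below.
  obtain ⟨β, -, φ, hφ, hlim⟩ := isCompact_Icc.tendsto_subseq hbd
  have ht' := ht.comp hφ.tendsto_atTop
  refine ⟨β, fun x hx hxT => le_antisymm ?_ ?_⟩
  · exact le_of_tendsto_div hT (fun n => h (φ n)) ht' hM (fun n => htT _) hlim hx hxT
  · have := le_of_tendsto_div (f := fun x => -f x) (β := -β) hT (fun n => (h (φ n)).neg) ht'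
      (by simpa using hM) (fun n => htT _) (by simpa [neg_div] using hlim.neg) hx hxT
    linarith

end TranslationCover

end LevelSets

/-! ### Subsums of a series that fill an interval. -/

namespace LevelSets

section Subsums

variable {a : ℕ → ℝ}

theorem tsum_indicator_union (hs : Summable a) {S S' : Set ℕ} (h : Disjoint S S') :
    ∑' n, (S ∪ S').indicator a n = ∑' n, S.indicator a n + ∑' n, S'.indicator a n := by
  rw [← (hs.indicator S).tsum_add (hs.indicator S')]
  congr 1 with n
  rw [indicator_union_of_disjoint h]

theorem tsum_indicator_mono (ha : ∀ n, 0 ≤ a n) (hs : Summable a) {S S' : Set ℕ} (h : S ⊆ S') :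
    ∑' n, S.indicator a n ≤ ∑' n, S'.indicator a n :=
  (hs.indicator S).tsum_le_tsum (fun n => indicator_le_indicator_of_subset h ha n)
    (hs.indicator S')

theorem tsum_indicator_finset (F : Finset ℕ) :
    ∑' n, (F : Set ℕ).indicator a n = ∑ n ∈ F, a n := by
  rw [tsum_eq_sum (s := F)]
  · exact Finset.sum_congr rfl fun n hn => indicator_of_mem (Finset.mem_coe.2 hn) a
  · intro n hn
    exact indicator_of_notMem (by simpa using hn) a

theorem tsum_indicator_Ici (hs : Summable a) (n : ℕ) :
    ∑' k, (Ici n).indicator a k = a n + ∑' k, (Ici (n + 1)).indicator a k := by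
  have h : Ici n = ((({n} : Finset ℕ) : Set ℕ)) ∪ Ici (n + 1) := by
    ext k; simp; omega
  rw [h, tsum_indicator_union hs (by simp), tsum_indicator_finset, Finset.sum_singleton]

theorem tendsto_tsum_indicator_Ici (hs : Summable a) :
    Tendsto (fun n => ∑' k, (Ici n).indicator a k) atTop (𝓝 0) := by
  have h : ∀ n, ∑' k, (Ici n).indicator a k = ∑' k, a k - ∑ k ∈ Finset.range n, a k := by
    intro n
    have h1 : (univ : Set ℕ) = (Finset.range n : Set ℕ) ∪ Ici n := by
      ext k; simp
    have h2 := tsum_indicator_union hs (S := (Finset.range n : Set ℕ)) (S' := Ici n)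
      (by rw [Set.disjoint_left]; intro k; simp)
    rw [← h1, indicator_univ, tsum_indicator_finset] at h2
    linarith
  simp only [h]
  simpa using hs.hasSum.tendsto_sum_nat.const_sub (∑' k, a k)

/-- The remainder of the greedy expansion of `x` after the terms `a 0, …, a (n - 1)`. -/
noncomputable def greedyRemainder (a : ℕ → ℝ) (x : ℝ) : ℕ → ℝ
  | 0 => x
  | n + 1 => if a n ≤ greedyRemainder a x n then greedyRemainder a x n - a n
      else greedyRemainder a x n

/-- If no term of a summable nonnegative sequence exceeds the sum of the later ones, then the
subsums fill an interval. -/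
theorem exists_subsum_eq (hs : Summable a)
    (htail : ∀ n, a n ≤ ∑' k, (Ici (n + 1)).indicator a k) {x : ℝ} (hx : 0 ≤ x)
    (hxT : x ≤ ∑' n, a n) : ∃ S : Set ℕ, ∑' n, S.indicator a n = x := by
  set r := greedyRemainder a x with hr
  have hr1 : ∀ n, r (n + 1) = if a n ≤ r n then r n - a n else r n := fun n => rfl
  -- The remainder never exceeds what the later terms can still supply: a skipped term exceeds the
  -- remainder, and the tail exceeds or equals that term.
  have hinv : ∀ n, 0 ≤ r n ∧ r n ≤ ∑' k, (Ici n).indicator a k := by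
    intro n
    induction n with
    | zero =>
      refine ⟨hx, ?_⟩
      have : (Ici 0 : Set ℕ) = univ := by ext; simp
      rw [this, indicator_univ]; exact hxT
    | succ n ih =>
      rw [hr1]
      split_ifs with h
      · have := tsum_indicator_Ici hs n
        exact ⟨by linarith, by linarith⟩
      · exact ⟨ih.1, by linarith [htail n]⟩
  have hlim : Tendsto r atTop (𝓝 0) :=
    tendsto_of_tendsto_of_tendsto_of_le_of_le tendsto_const_nhds (tendsto_tsum_indicator_Ici hs)
      (fun n => (hinv n).1) (fun n => (hinv n).2)
  refine ⟨{n | a n ≤ r n}, ?_⟩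
  have hsum : ∀ n, ∑ k ∈ Finset.range n, {n | a n ≤ r n}.indicator a k = x - r n := by
    intro n
    induction n with
    | zero => simp [hr, greedyRemainder]
    | succ n ih =>
      rw [Finset.sum_range_succ, ih, hr1, indicator_apply]
      simp only [mem_ofPred_eq]
      split_ifs <;> ring
  have h1 := (hs.indicator {n | a n ≤ r n}).hasSum.tendsto_sum_nat
  simp only [hsum] at h1
  have h2 := hlim.const_sub x
  rw [sub_zero] at h2
  exact tendsto_nhds_unique h1 h2

theorem exists_subsum_Ici_eq (ha : ∀ n, 0 ≤ a n) (hs : Summable a)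
    (htail : ∀ n, a n ≤ ∑' k, (Ici (n + 1)).indicator a k) (N : ℕ) {x : ℝ} (hx : 0 ≤ x)
    (hxT : x ≤ ∑' n, (Ici N).indicator a n) :
    ∃ S : Set ℕ, S ⊆ Ici N ∧ ∑' n, S.indicator a n = x := by
  have hnn : ∀ n, 0 ≤ (Ici N).indicator a n := fun n => indicator_nonneg (fun k _ => ha k) n
  obtain ⟨S, hS⟩ := exists_subsum_eq (a := (Ici N).indicator a) (hs.indicator _) (by
    intro n
    by_cases hn : N ≤ n
    · rw [indicator_of_mem (by exact hn), indicator_indicator, inter_eq_left.2]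
      · exact htail n
      · exact Ici_subset_Ici.2 (by omega)
    · rw [indicator_of_notMem (by exact hn)]
      exact tsum_nonneg fun k => indicator_nonneg (fun k _ => hnn k) k) hx hxT
  refine ⟨S ∩ Ici N, inter_subset_right, ?_⟩
  rw [← hS]
  simp only [indicator_indicator]

variable {f : ℝ → ℝ} {M : ℝ}

theorem add_of_subsums (hs : Summable a)
    (hf : ∀ S : Set ℕ, HasSum (S.indicator fun n => f (a n)) (f (∑' n, S.indicator a n)))
    {S S' : Set ℕ} (h : Disjoint S S') :
    f (∑' n, S.indicator a n + ∑' n, S'.indicator a n) =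
      f (∑' n, S.indicator a n) + f (∑' n, S'.indicator a n) := by
  rw [← tsum_indicator_union hs h]
  refine (hf (S ∪ S')).unique ?_
  rw [indicator_union_of_disjoint h]
  exact (hf S).add (hf S')

theorem abs_le_of_subsums (hs : Summable a)
    (hf : ∀ S : Set ℕ, HasSum (S.indicator fun n => f (a n)) (f (∑' n, S.indicator a n)))
    (hM : ∀ n, |f (a n)| ≤ M * a n) (S : Set ℕ) :
    |f (∑' n, S.indicator a n)| ≤ M * ∑' n, S.indicator a n := by
  have h1 := ((hs.indicator S).hasSum).mul_left M
  have h2 : ∀ n, |S.indicator (fun n => f (a n)) n| ≤ M * S.indicator a n := by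
    intro n
    by_cases hn : n ∈ S
    · simpa [hn] using hM n
    · simp [hn]
  rw [abs_le']
  exact ⟨hasSum_le (fun n => (abs_le'.1 (h2 n)).1) (hf S) h1,
    hasSum_le (fun n => (abs_le'.1 (h2 n)).2) (hf S).neg h1⟩

/-- The starts are the subsums of the first `N` terms and the window length is the tail sum. Subsums
of the tail fill `[0, t]` and use indices disjoint from those of the start, so `f` adds. -/
theorem translationCover_subsums (ha : ∀ n, 0 < a n) (hs : Summable a)
    (htail : ∀ n, a n ≤ ∑' k, (Ici (n + 1)).indicator a k)
    (hf : ∀ S : Set ℕ, HasSum (S.indicator fun n => f (a n)) (f (∑' n, S.indicator a n)))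
    (N : ℕ) :
    TranslationCover f (∑' n, a n) (∑' k, (Ici N).indicator a k)
      ((Finset.range N).powerset.image fun F : Finset ℕ => ∑' n, (F : Set ℕ).indicator a n) := by
  have ha' : ∀ n, 0 ≤ a n := fun n => (ha n).le
  have hdisj : ∀ F ⊆ Finset.range N, Disjoint (F : Set ℕ) (Ici N) := by
    intro F hF
    rw [Set.disjoint_left]
    intro k hk
    have := hF (Finset.mem_coe.1 hk)
    simpa using this
  refine ⟨?_, ?_, ?_, ?_, ?_⟩
  · rw [tsum_indicator_Ici hs]
    exact add_pos_of_pos_of_nonneg (ha N)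
      (tsum_nonneg fun k => indicator_nonneg (fun k _ => ha' k) k)
  · intro s h
    simp only [Finset.mem_image] at h
    obtain ⟨F, -, rfl⟩ := h
    exact tsum_nonneg fun k => indicator_nonneg (fun k _ => ha' k) k
  · intro s h
    simp only [Finset.mem_image, Finset.mem_powerset] at h
    obtain ⟨F, hF, rfl⟩ := h
    rw [← tsum_indicator_union hs (hdisj F hF)]
    refine (tsum_indicator_mono ha' hs (subset_univ _)).trans ?_
    rw [indicator_univ]
  · intro x hx hxT
    obtain ⟨S, rfl⟩ := exists_subsum_eq hs htail hx hxT
    classical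
    set F := (Finset.range N).filter (· ∈ S) with hF
    have hsub : F ⊆ Finset.range N := Finset.filter_subset _ _
    have hS : S = (F : Set ℕ) ∪ (S ∩ Ici N) := by
      ext k
      simp only [hF, Finset.coe_filter, Finset.mem_range, mem_union, mem_ofPred_eq, mem_inter_iff,
        mem_Ici]
      constructor
      · intro h
        rcases lt_or_ge k N with h' | h'
        · exact Or.inl ⟨h', h⟩
        · exact Or.inr ⟨h, h'⟩
      · rintro (h | h)
        · exact h.2
        · exact h.1
    refine ⟨_, Finset.mem_image_of_mem _ (Finset.mem_powerset.2 hsub), ?_, ?_⟩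
    · refine tsum_indicator_mono ha' hs ?_
      rw [hS]; exact subset_union_left
    · conv_lhs => rw [hS]
      rw [tsum_indicator_union hs ((hdisj F hsub).mono_right inter_subset_right)]
      exact add_le_add le_rfl (tsum_indicator_mono ha' hs inter_subset_right)
  · intro s h z hz hzt
    simp only [Finset.mem_image, Finset.mem_powerset] at h
    obtain ⟨F, hF, rfl⟩ := h
    obtain ⟨S, hS, rfl⟩ := exists_subsum_Ici_eq ha' hs htail N hz hzt
    exact add_of_subsums hs hf ((hdisj F hF).mono_right hS)

/-- A function which is additive on the subsums of a sequence that fill an interval is linear on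
this interval, provided that it has bounded quotients along the sequence. -/
theorem exists_linear_of_subsums (ha : ∀ n, 0 < a n) (hs : Summable a)
    (htail : ∀ n, a n ≤ ∑' k, (Ici (n + 1)).indicator a k)
    (hf : ∀ S : Set ℕ, HasSum (S.indicator fun n => f (a n)) (f (∑' n, S.indicator a n)))
    (hM : ∀ n, |f (a n)| ≤ M * a n) :
    ∃ α : ℝ, ∀ x, 0 ≤ x → x ≤ ∑' n, a n → f x = α * x := by
  have ha' : ∀ n, 0 ≤ a n := fun n => (ha n).le
  refine TranslationCover.linear (M := M) (hs.tsum_pos ha' 0 (ha 0))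
    (translationCover_subsums ha hs htail hf) (tendsto_tsum_indicator_Ici hs) ?_ ?_
  · intro z hz hzT
    obtain ⟨S, rfl⟩ := exists_subsum_eq hs htail hz hzT
    exact abs_le_of_subsums hs hf hM S
  · intro n
    refine (tsum_indicator_mono ha' hs (subset_univ _)).trans ?_
    rw [indicator_univ]

end Subsums

end LevelSets

/-! ### Functions additive along a positive measure, atoms, and exhaustion. -/

namespace LevelSets

variable {Ω : Type*} [MeasurableSpace Ω]

/-- The set function `A ↦ f (m A)` is countably additive on the sets of finite measure. -/
def IsAdditiveAlong (m : Measure Ω) (f : ℝ → ℝ) : Prop :=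
  ∀ A : ℕ → Set Ω, (∀ i, MeasurableSet (A i)) → Pairwise (Function.onFun Disjoint A) →
    m (⋃ i, A i) ≠ ∞ → HasSum (fun i => f (m.real (A i))) (f (m.real (⋃ i, A i)))

/-- The range of `m` is an interval. -/
def HasFullRange (m : Measure Ω) : Prop :=
  ∀ x : ℝ≥0∞, x ≤ m univ → ∃ A, MeasurableSet A ∧ m A = x

/-- `A` is an atom of the positive measure `m`. -/
def IsAtomOfMeasure (m : Measure Ω) (A : Set Ω) : Prop :=
  MeasurableSet A ∧ m A ≠ 0 ∧ ∀ B, MeasurableSet B → B ⊆ A → m B = 0 ∨ m (A \ B) = 0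

variable {m : Measure Ω} {f : ℝ → ℝ}

/-- An atom met in a nonnull set is almost contained in that set. Consequently sets smaller than an
atom miss it up to a null set, and atoms of different sizes are almost disjoint. -/
theorem IsAtomOfMeasure.le_of_inter_ne_zero {A B : Set Ω} (hA : IsAtomOfMeasure m A)
    (hB : MeasurableSet B) (h : m (A ∩ B) ≠ 0) : m A ≤ m B := by
  have h1 := (hA.2.2 (A ∩ B) (hA.1.inter hB) inter_subset_left).resolve_left h
  rw [sdiff_self_inter] at h1
  calc m A ≤ m (A \ B) + m B := by
        refine (measure_mono ?_).trans (measure_union_le _ _)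
        rw [sdiff_union_self]; exact subset_union_left
    _ = m B := by rw [h1, zero_add]

theorem IsAtomOfMeasure.inter_null_of_lt {A B : Set Ω} (hA : IsAtomOfMeasure m A)
    (hB : MeasurableSet B) (h : m B < m A) : m (A ∩ B) = 0 := by
  by_contra hne
  exact absurd (hA.le_of_inter_ne_zero hB hne) (not_le.2 h)

theorem IsAtomOfMeasure.inter_null_of_ne {A B : Set Ω} (hA : IsAtomOfMeasure m A)
    (hB : IsAtomOfMeasure m B) (h : m A ≠ m B) : m (A ∩ B) = 0 := by
  rcases lt_or_gt_of_ne h with h | h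
  · rw [inter_comm]; exact hB.inter_null_of_lt hA.1 h
  · exact hA.inter_null_of_lt hB.1 h

namespace IsAdditiveAlong

/-- For a sequence of empty sets the series is constant, and a constant series converges only if its
term is zero. -/
theorem map_zero (hf : IsAdditiveAlong m f) : f 0 = 0 := by
  have h := hf (fun _ => ∅) (fun _ => .empty) (fun i j _ => by simp) (by simp)
  simp only [measureReal_empty, iUnion_empty] at h
  exact (summable_const_iff _).1 h.summable

theorem map_union (hf : IsAdditiveAlong m f) {A B : Set Ω} (hA : MeasurableSet A)
    (hB : MeasurableSet B) (hAB : Disjoint A B) (hAm : m A ≠ ∞) (hBm : m B ≠ ∞) :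
    f (m.real A + m.real B) = f (m.real A) + f (m.real B) := by
  set C : ℕ → Set Ω := fun n => if n = 0 then A else if n = 1 then B else ∅ with hC
  have hCU : ⋃ n, C n = A ∪ B := by
    ext x
    simp only [hC, mem_iUnion, mem_union]
    constructor
    · rintro ⟨n, hn⟩
      split_ifs at hn
      · exact Or.inl hn
      · exact Or.inr hn
      · exact absurd hn (notMem_empty x)
    · rintro (h | h)
      · exact ⟨0, by simpa using h⟩
      · exact ⟨1, by simpa using h⟩
  have h := hf C (fun n => by simp only [hC]; split_ifs <;> simp [hA, hB]) (by
    intro i j hij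
    simp only [Function.onFun, hC]
    split_ifs <;> simp_all [hAB.symm]) (by
    rw [hCU]; exact (measure_union_lt_top hAm.lt_top hBm.lt_top).ne)
  rw [hCU, measureReal_union hAB hB hAm hBm] at h
  refine h.unique ?_
  have h2 : HasSum (fun i => f (m.real (C i))) _ := hasSum_sum_of_ne_finset_zero (s := {0, 1}) (by
    intro n hn
    simp only [Finset.mem_insert, Finset.mem_singleton, not_or] at hn
    simp [hC, hn.1, hn.2, hf.map_zero])
  simpa [hC] using h2

theorem map_union_of_null_inter (hf : IsAdditiveAlong m f) {A B : Set Ω} (hA : MeasurableSet A)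
    (hB : MeasurableSet B) (hAB : m (A ∩ B) = 0) (hAm : m A ≠ ∞) (hBm : m B ≠ ∞) :
    f (m.real A + m.real B) = f (m.real A) + f (m.real B) := by
  have h1 : m (B \ A) = m B := by
    rw [← measure_sdiff_add_inter B hA, inter_comm B A, hAB, add_zero]
  have h2 := hf.map_union hA (hB.diff hA) disjoint_sdiff_right hAm (by rwa [h1])
  rwa [measureReal_def m (B \ A), h1] at h2

theorem sub_linear (hf : IsAdditiveAlong m f) (α : ℝ) :
    IsAdditiveAlong m (fun x => f x - α * x) := by
  intro A hA hd hfin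
  refine (hf A hA hd hfin).sub (HasSum.mul_left α ?_)
  have h : m.real (⋃ i, A i) = ∑' i, m.real (A i) := by
    rw [measureReal_def, measure_iUnion hd hA, ENNReal.tsum_toReal_eq]
    · rfl
    · exact fun i => ((measure_mono (subset_iUnion A i)).trans_lt hfin.lt_top).ne
  rw [h]
  refine (ENNReal.summable_toReal ?_).hasSum
  rwa [← measure_iUnion hd hA]

end IsAdditiveAlong

theorem measureReal_biUnion_eq_tsum {A : ℕ → Set Ω} (hA : ∀ i, MeasurableSet (A i))
    (hd : Pairwise (Function.onFun Disjoint A)) (hfin : m (⋃ i, A i) ≠ ∞) (S : Set ℕ) :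
    m.real (⋃ i ∈ S, A i) = ∑' i, S.indicator (fun i => m.real (A i)) i := by
  rw [measureReal_def, measure_biUnion (to_countable S) (fun i _ j _ h => hd h) (fun i _ => hA i),
    tsum_subtype S (fun i => m (A i)), ENNReal.tsum_toReal_eq]
  · congr 1 with i
    by_cases hi : i ∈ S <;> simp [hi, measureReal_def]
  · intro i
    by_cases hi : i ∈ S
    · simpa [hi] using ((measure_mono (subset_iUnion A i)).trans_lt hfin.lt_top).ne
    · simp [hi]

/-- Linearity of `f` on an interval, from a sequence of disjoint sets none of which is larger
than the union of the later ones. -/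
theorem exists_linear_of_disjoint_sequence (hf : IsAdditiveAlong m f) {A : ℕ → Set Ω} {M : ℝ}
    (hA : ∀ i, MeasurableSet (A i))
    (hd : Pairwise (Function.onFun Disjoint A)) (hfin : m (⋃ i, A i) ≠ ∞)
    (hpos : ∀ n, 0 < m.real (A n))
    (htail : ∀ n, m.real (A n) ≤ m.real (⋃ k ∈ Ici (n + 1), A k))
    (hM : ∀ n, |f (m.real (A n))| ≤ M * m.real (A n)) :
    ∃ α : ℝ, ∀ x, 0 ≤ x → x ≤ m.real (⋃ i, A i) → f x = α * x := by
  have hT : m.real (⋃ i, A i) = ∑' i, m.real (A i) := by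
    simpa using measureReal_biUnion_eq_tsum hA hd hfin univ
  rw [hT]
  have hs : Summable fun i => m.real (A i) := by
    refine ENNReal.summable_toReal ?_
    rwa [← measure_iUnion hd hA]
  refine exists_linear_of_subsums hpos hs ?_ ?_ hM
  · intro n
    rw [← measureReal_biUnion_eq_tsum hA hd hfin]
    exact htail n
  · intro S
    rw [← measureReal_biUnion_eq_tsum hA hd hfin]
    have hsub : ∀ i, (⋃ _ : i ∈ S, A i) ⊆ A i := fun i => iUnion_subset fun _ => subset_rfl
    have h := hf (fun i => ⋃ _ : i ∈ S, A i) (fun i => .iUnion fun _ => hA i)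
      (fun i j hij => (hd hij).mono (hsub i) (hsub j))
      ((measure_mono (iUnion_mono hsub)).trans_lt hfin.lt_top).ne
    convert h using 2 with i
    by_cases hi : i ∈ S <;> simp [hi, hf.map_zero]

/-- The sets obtained by repeatedly adjoining `g B` to `B`. -/
def iterUnion {X : Type*} (g : Set X → Set X) : ℕ → Set X
  | 0 => ∅
  | n + 1 => iterUnion g n ∪ g (iterUnion g n)

theorem iterUnion_eq_biUnion {X : Type*} (g : Set X → Set X) (n : ℕ) :
    iterUnion g n = ⋃ k < n, g (iterUnion g k) := by
  induction n with
  | zero => simp [iterUnion]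
  | succ n ih => rw [biUnion_lt_succ, ← ih, iterUnion]

theorem iterUnion_subset {X : Type*} (g : Set X → Set X) (n : ℕ) :
    iterUnion g n ⊆ ⋃ k, g (iterUnion g k) := by
  rw [iterUnion_eq_biUnion]
  exact iUnion₂_subset fun k _ => subset_iUnion (fun k => g (iterUnion g k)) k

theorem iUnion_iterUnion {X : Type*} (g : Set X → Set X) :
    ⋃ n, iterUnion g n = ⋃ k, g (iterUnion g k) := by
  refine subset_antisymm (iUnion_subset (iterUnion_subset g)) (iUnion_subset fun k => ?_)
  refine subset_trans ?_ (subset_iUnion _ (k + 1))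
  exact subset_union_right

theorem monotone_iterUnion {X : Type*} (g : Set X → Set X) : Monotone (iterUnion g) :=
  monotone_nat_of_le_succ fun _ => subset_union_left

theorem pairwise_disjoint_of_iterUnion {X : Type*} {g : Set X → Set X}
    (hg : ∀ n, Disjoint (g (iterUnion g n)) (iterUnion g n)) :
    Pairwise (Function.onFun Disjoint fun n => g (iterUnion g n)) := by
  have h : ∀ i j, i < j → Disjoint (g (iterUnion g i)) (g (iterUnion g j)) := by
    intro i j hij
    refine ((hg j).mono_right ?_).symm
    rw [iterUnion_eq_biUnion g j]
    exact subset_biUnion_of_mem (u := fun k => g (iterUnion g k)) hij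
  intro i j hij
  rcases lt_or_gt_of_ne hij with h' | h'
  · exact h i j h'
  · exact (h j i h').symm

/-- Exhaustion: a disjoint sequence of admissible sets after which all admissible sets
are null. -/
theorem exists_exhaustion {K : ℝ≥0∞} (hK : K ≠ ∞) {P : Set Ω → Set Ω → Prop}
    (hanti : ∀ B B' C, B' ⊆ B → P B C → P B' C) (hPK : ∀ B C, P B C → m (B ∪ C) ≤ K) :
    ∃ C : ℕ → Set Ω, (∀ n, MeasurableSet (C n)) ∧ Pairwise (Function.onFun Disjoint C) ∧
      (∀ n, C n = ∅ ∨ P ∅ (C n)) ∧ m (⋃ n, C n) ≤ K ∧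
      ∀ D, MeasurableSet D → Disjoint D (⋃ n, C n) → P (⋃ n, C n) D → m D = 0 := by
  -- The next set has at least half the supremum of the available measures; the empty set is taken
  -- when this supremum is zero.
  have hstep : ∀ B : Set Ω, ∃ C, MeasurableSet C ∧ Disjoint C B ∧ (C = ∅ ∨ P B C) ∧
      ∀ D, MeasurableSet D → Disjoint D B → P B D → m D ≤ 2 * m C := by
    intro B
    set s := ⨆ C : {C // MeasurableSet C ∧ Disjoint C B ∧ P B C}, m C.1 with hs
    have hsK : s ≤ K := iSup_le fun C =>
      (measure_mono subset_union_right).trans (hPK B C.1 C.2.2.2)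
    have hle : ∀ D, MeasurableSet D → Disjoint D B → P B D → m D ≤ s := fun D h1 h2 h3 =>
      le_iSup (fun C : {C // MeasurableSet C ∧ Disjoint C B ∧ P B C} => m C.1) ⟨D, h1, h2, h3⟩
    by_cases hs0 : s = 0
    · refine ⟨∅, .empty, by simp, Or.inl rfl, fun D h1 h2 h3 => ?_⟩
      simpa [hs0] using hle D h1 h2 h3
    · have hlt : s / 2 < s := ENNReal.half_lt_self hs0 (ne_top_of_le_ne_top hK hsK)
      obtain ⟨C, hC⟩ := lt_iSup_iff.1 hlt
      refine ⟨C.1, C.2.1, C.2.2.1, Or.inr C.2.2.2, fun D h1 h2 h3 => ?_⟩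
      refine (hle D h1 h2 h3).trans ?_
      rw [mul_comm, ← ENNReal.div_le_iff (by simp) (by simp)]
      exact hC.le
  choose g hg1 hg2 hg3 hg4 using hstep
  have hd := pairwise_disjoint_of_iterUnion fun n => hg2 (iterUnion g n)
  have hbd : ∀ n, m (iterUnion g n) ≤ K := by
    intro n
    induction n with
    | zero => simp [iterUnion]
    | succ n ih =>
      rw [iterUnion]
      rcases hg3 (iterUnion g n) with h | h
      · rw [h, union_empty]; exact ih
      · exact hPK _ _ h
  have hU : m (⋃ n, g (iterUnion g n)) ≤ K := by
    rw [← iUnion_iterUnion, (monotone_iterUnion g).measure_iUnion]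
    exact iSup_le hbd
  refine ⟨fun n => g (iterUnion g n), fun n => hg1 _, hd,
    fun n => (hg3 _).imp_right (hanti _ _ _ (empty_subset _)), hU, fun D hD hdisj hP => ?_⟩
  -- A set admissible at the end was admissible at every stage, so it is bounded by twice the terms
  -- of a convergent series.
  have hle : ∀ n, m D ≤ 2 * m (g (iterUnion g n)) := fun n =>
    hg4 _ D hD (hdisj.mono_right (iterUnion_subset g n)) (hanti _ _ _ (iterUnion_subset g n) hP)
  have hfin : ∑' n, m (g (iterUnion g n)) ≠ ∞ := by
    rw [← measure_iUnion hd fun n => hg1 _]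
    exact ne_top_of_le_ne_top hK hU
  have h1 := ENNReal.Tendsto.const_mul (a := 2)
    (ENNReal.tendsto_atTop_zero_of_tsum_ne_top hfin) (Or.inr (by simp))
  rw [mul_zero] at h1
  exact le_antisymm (ge_of_tendsto' h1 hle) zero_le

end LevelSets

/-! ### Linearity near zero: the fine and the coarse case. -/

namespace LevelSets

theorem tsum_indicator_Ici_of_telescoping {a w : ℕ → ℝ} (hs : Summable a)
    (hw : Tendsto w atTop (𝓝 0)) (h : ∀ n, a n = w n - w (n + 1)) (n : ℕ) :
    ∑' k, (Ici n).indicator a k = w n := by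
  set u : ℕ → ℝ := fun n => ∑' k, (Ici n).indicator a k with hu
  have h1 : ∀ j, u (n + j) - w (n + j) = u n - w n := by
    intro j
    induction j with
    | zero => rfl
    | succ j ih =>
      have h2 : u (n + j) = a (n + j) + u (n + j + 1) := tsum_indicator_Ici hs (n + j)
      rw [← ih, h2, h (n + j), add_assoc]
      ring
  have h2 : Tendsto (fun j => u (n + j) - w (n + j)) atTop (𝓝 (0 - 0)) := by
    have h3 : Tendsto (fun j => n + j) atTop atTop := tendsto_atTop_mono (by simp) tendsto_id
    exact ((tendsto_tsum_indicator_Ici hs).comp h3).sub (hw.comp h3)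
  simp only [h1] at h2
  have h3 := tendsto_nhds_unique tendsto_const_nhds h2
  change u n = w n
  linarith

variable {Ω : Type*} [MeasurableSpace Ω] {m : Measure Ω} {f : ℝ → ℝ}

/-- Every complement of a set of measure less than `T` has arbitrarily small subsets of positive
measure. -/
def IsFineBelow (m : Measure Ω) (T : ℝ≥0∞) : Prop :=
  ∀ B, MeasurableSet B → m B < T → ∀ r : ℝ≥0∞, r ≠ 0 →
    ∃ C, MeasurableSet C ∧ Disjoint C B ∧ m C ≠ 0 ∧ m C ≤ r

namespace IsFineBelow

variable {T : ℝ≥0∞}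

/-- Exhaust the complement of `B` by sets of total measure at most `y`. A deficit would leave room
for a further small nonnull set, against maximality. -/
theorem exists_disjoint_measure_eq (h : IsFineBelow m T) {B : Set Ω}
    (hB : MeasurableSet B) {y : ℝ≥0∞} (hy : m B + y < T) :
    ∃ C, MeasurableSet C ∧ Disjoint C B ∧ m C = y := by
  have hyT : y ≠ ∞ := ((le_add_self).trans_lt hy).ne_top
  obtain ⟨C, hC, -, hP, hle, hmax⟩ := exists_exhaustion (m := m) hyT
    (P := fun B' C => m (B' ∪ C) ≤ y ∧ Disjoint C B)
    (fun B B' C hBB h => ⟨(measure_mono (union_subset_union_left C hBB)).trans h.1, h.2⟩)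
    (fun B C h => h.1)
  have hdisj : Disjoint (⋃ n, C n) B := by
    rw [disjoint_iUnion_left]
    intro n
    rcases hP n with h0 | h0
    · simp [h0]
    · exact h0.2
  have hU : MeasurableSet (⋃ n, C n) := .iUnion hC
  refine ⟨_, hU, hdisj, hle.eq_of_not_lt fun hlt => ?_⟩
  obtain ⟨D, hD, hDd, hD0, hDr⟩ := h (B ∪ ⋃ n, C n) (hB.union hU)
    ((measure_union_le _ _).trans_lt (lt_of_le_of_lt (by gcongr) hy)) (y - m (⋃ n, C n))
    (tsub_pos_of_lt hlt).ne'
  rw [disjoint_union_right] at hDd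
  refine hD0 (hmax D hD hDd.2 ⟨(measure_union_le _ _).trans ?_, hDd.1⟩)
  calc m (⋃ n, C n) + m D ≤ m (⋃ n, C n) + (y - m (⋃ n, C n)) := by gcongr
    _ = y := add_tsub_cancel_of_le hle

theorem map_add (h : IsFineBelow m T) (hf : IsAdditiveAlong m f) {x y : ℝ≥0∞}
    (hxy : x + y < T) : f (x.toReal + y.toReal) = f x.toReal + f y.toReal := by
  obtain ⟨A, hA, -, hAx⟩ := h.exists_disjoint_measure_eq (B := ∅) .empty (y := x)
    (by simpa using le_self_add.trans_lt hxy)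
  obtain ⟨B, hB, hd, hBy⟩ := h.exists_disjoint_measure_eq hA (y := y) (by rwa [hAx])
  have hx := (le_self_add.trans_lt hxy).ne_top
  have hy := (le_add_self.trans_lt hxy).ne_top
  have := hf.map_union hA hB hd.symm (by rwa [hAx]) (by rwa [hBy])
  rwa [measureReal_def, measureReal_def, hAx, hBy] at this

/-- Each new set takes half of what is left of `τ = T / 2`, so every set is exactly as large as the
union of the later ones. -/
theorem exists_linear (h : IsFineBelow m T) (hT0 : T ≠ 0) (hT : T ≠ ∞)
    (hf : IsAdditiveAlong m f) :
    ∃ T' : ℝ, 0 < T' ∧ ENNReal.ofReal T' ≤ m univ ∧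
      ∃ α : ℝ, ∀ x, 0 ≤ x → x ≤ T' → f x = α * x := by
  set τ := T / 2 with hτ
  have hτT : τ < T := ENNReal.half_lt_self hT0 hT
  have hτ0 : τ ≠ 0 := (ENNReal.half_pos hT0).ne'
  have hτfin : τ ≠ ∞ := hτT.ne_top
  have hstep : ∀ B : Set Ω, ∃ C, MeasurableSet C ∧ Disjoint C B ∧
      (MeasurableSet B → m B ≤ τ → m C = (τ - m B) / 2) := by
    intro B
    by_cases hB : MeasurableSet B ∧ m B ≤ τ
    · obtain ⟨C, h1, h2, h3⟩ := h.exists_disjoint_measure_eq hB.1 (y := (τ - m B) / 2) (by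
        refine lt_of_le_of_lt ?_ hτT
        calc m B + (τ - m B) / 2 ≤ m B + (τ - m B) := by gcongr; exact ENNReal.half_le_self
          _ = τ := add_tsub_cancel_of_le hB.2)
      exact ⟨C, h1, h2, fun _ _ => h3⟩
    · exact ⟨∅, .empty, by simp, fun h1 h2 => absurd ⟨h1, h2⟩ hB⟩
  choose g hg1 hg2 hg3 using hstep
  have hBm : ∀ n, MeasurableSet (iterUnion g n) := by
    intro n
    induction n with
    | zero => exact .empty
    | succ n ih => exact ih.union (hg1 _)
  have hBval : ∀ n, m (iterUnion g n) + τ / 2 ^ n = τ := by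
    intro n
    induction n with
    | zero => simp [iterUnion]
    | succ n ih =>
      have hle : m (iterUnion g n) ≤ τ := le_self_add.trans ih.le
      have hfin : m (iterUnion g n) ≠ ∞ := ne_top_of_le_ne_top hτfin hle
      have h2 : τ - m (iterUnion g n) = τ / 2 ^ n := ENNReal.sub_eq_of_eq_add_rev hfin ih.symm
      rw [iterUnion, measure_union (hg2 _).symm (hg1 _), hg3 _ (hBm n) hle, h2, add_assoc]
      have h3 : τ / 2 ^ (n + 1) = τ / 2 ^ n / 2 := by
        rw [pow_succ, div_eq_mul_inv, div_eq_mul_inv, div_eq_mul_inv,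
          ENNReal.mul_inv (by simp) (by simp), mul_assoc]
      rw [h3, ENNReal.add_halves]
      exact ih
  have hval : ∀ n, m (g (iterUnion g n)) = τ / 2 ^ n / 2 := by
    intro n
    have hle : m (iterUnion g n) ≤ τ := le_self_add.trans (hBval n).le
    rw [hg3 _ (hBm n) hle, ENNReal.sub_eq_of_eq_add_rev (ne_top_of_le_ne_top hτfin hle)
      (hBval n).symm]
  have hreal : ∀ n, m.real (g (iterUnion g n)) = τ.toReal / 2 ^ n / 2 := by
    intro n
    rw [measureReal_def, hval]
    simp
  have hτpos : 0 < τ.toReal := ENNReal.toReal_pos hτ0 hτfin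
  have hd := pairwise_disjoint_of_iterUnion fun n => hg2 (iterUnion g n)
  have hU : m (⋃ n, g (iterUnion g n)) ≠ ∞ := by
    rw [← iUnion_iterUnion, (monotone_iterUnion g).measure_iUnion]
    exact ne_top_of_le_ne_top hτfin (iSup_le fun n => le_self_add.trans (hBval n).le)
  have hsum : Summable fun n => m.real (g (iterUnion g n)) := by
    refine ENNReal.summable_toReal ?_
    rwa [← measure_iUnion hd fun n => hg1 _]
  -- Additivity of `f` below `T` makes `f` halve along with the measures; the quotients are
  -- constant, and the first one supplies `M`.
  have hhalf : ∀ n, f (m.real (g (iterUnion g n))) = 2 * f (m.real (g (iterUnion g (n + 1)))) := by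
    intro n
    have h1 : τ / 2 ^ (n + 1) / 2 + τ / 2 ^ (n + 1) / 2 < T := by
      rw [ENNReal.add_halves]
      exact (le_add_self.trans (hBval (n + 1)).le).trans_lt hτT
    have h2 := h.map_add hf h1
    rw [← hval, ← measureReal_def] at h2
    rw [two_mul, ← h2, hreal, hreal]
    congr 1
    field_simp
    ring
  obtain ⟨α, hα⟩ := exists_linear_of_disjoint_sequence hf (fun n => hg1 (iterUnion g n)) hd hU
    (M := |f (m.real (g (iterUnion g 0)))| / m.real (g (iterUnion g 0)))
    (fun n => by rw [hreal]; positivity)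
    (by
      intro n
      rw [measureReal_biUnion_eq_tsum (fun n => hg1 (iterUnion g n)) hd hU,
        tsum_indicator_Ici_of_telescoping (w := fun n => τ.toReal / 2 ^ n) hsum]
      · rw [hreal]; apply le_of_eq; field_simp; ring
      · have := (tendsto_pow_atTop_nhds_zero_of_lt_one (r := (1 / 2 : ℝ)) (by norm_num)
          (by norm_num)).const_mul τ.toReal
        simpa [div_eq_mul_inv] using this
      · intro k; rw [hreal]; field_simp; ring)
    (by
      intro n
      apply le_of_eq
      induction n with
      | zero =>
        rw [div_mul_cancel₀]
        rw [hreal]; positivity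
      | succ n ih =>
        rw [hhalf, abs_mul, abs_two] at ih
        have h2 : m.real (g (iterUnion g n)) = 2 * m.real (g (iterUnion g (n + 1))) := by
          rw [hreal, hreal]; field_simp; ring
        rw [h2] at ih
        linarith)
  refine ⟨m.real (⋃ n, g (iterUnion g n)), ?_, ?_, α, hα⟩
  · refine lt_of_lt_of_le (?_ : 0 < m.real (g (iterUnion g 0))) (measureReal_mono ?_ hU)
    · rw [hreal]; positivity
    · exact subset_iUnion (fun n => g (iterUnion g n)) 0
  · rw [measureReal_def, ENNReal.ofReal_toReal hU]
    exact measure_mono (subset_univ _)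

end IsFineBelow

theorem not_isFineBelow_iff {T : ℝ≥0∞} : ¬ IsFineBelow m T ↔
    ∃ B, MeasurableSet B ∧ m B < T ∧ ∃ r : ℝ≥0∞, r ≠ 0 ∧
      ∀ C, MeasurableSet C → Disjoint C B → m C ≤ r → m C = 0 := by
  simp only [IsFineBelow]
  push Not
  refine exists_congr fun B => and_congr_right fun _ => and_congr_right fun _ =>
    exists_congr fun r => and_congr_right fun _ => forall_congr' fun C =>
    imp_congr_right fun _ => imp_congr_right fun _ => ?_
  constructor
  · intro h h1
    by_contra h2
    exact absurd h1 (not_le.2 (h h2))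
  · intro h h1
    by_contra h2
    exact h1 (h (not_lt.1 h2))

/-- Some `B` smaller than `D` has no nonnull sets of measure at most `r` outside it. A nonnull
subset of `D \ B` whose measure is within `r` of the infimum `σ` is an atom: in a splitting, one
piece has measure at least `σ` and the other more than `r`. -/
theorem exists_atom_subset (hcoarse : ∀ T : ℝ≥0∞, T ≠ 0 → T ≠ ∞ → ¬ IsFineBelow m T)
    {D : Set Ω} (hD : MeasurableSet D)
    (hD0 : m D ≠ 0) (hDfin : m D ≠ ∞) : ∃ A ⊆ D, IsAtomOfMeasure m A := by
  obtain ⟨B, hB, hBD, r, hr, hnull⟩ := not_isFineBelow_iff.1 (hcoarse (m D) hD0 hDfin)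
  have hpos : m (D \ B) ≠ 0 := fun h0 => by
    refine absurd hBD (not_lt.2 ?_)
    calc m D ≤ m (D \ B) + m B := by
          refine (measure_mono ?_).trans (measure_union_le _ _)
          rw [sdiff_union_self]; exact subset_union_left
      _ = m B := by rw [h0, zero_add]
  set σ := ⨅ C : {C // MeasurableSet C ∧ C ⊆ D \ B ∧ m C ≠ 0}, m C.1 with hσ
  have hle : ∀ C, MeasurableSet C → C ⊆ D \ B → m C ≠ 0 → σ ≤ m C := fun C h1 h2 h3 =>
    iInf_le (fun C : {C // MeasurableSet C ∧ C ⊆ D \ B ∧ m C ≠ 0} => m C.1) ⟨C, h1, h2, h3⟩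
  have hσfin : σ ≠ ∞ := ne_top_of_le_ne_top hDfin
    ((hle _ (hD.diff hB) subset_rfl hpos).trans (measure_mono sdiff_subset))
  obtain ⟨⟨C, hC, hCD, hC0⟩, hClt⟩ := iInf_lt_iff.1 (ENNReal.lt_add_right hσfin hr)
  refine ⟨C, hCD.trans sdiff_subset, hC, hC0, fun E hE hEC => ?_⟩
  by_contra! hcon
  have h1 := hle E hE (hEC.trans hCD) hcon.1
  have h2 : r < m (C \ E) := by
    by_contra h3
    refine hcon.2 (hnull _ (hC.diff hE) ?_ (not_lt.1 h3))
    exact disjoint_sdiff_left.mono_left (sdiff_subset.trans hCD)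
  have h3 : m E + m (C \ E) = m C := by
    rw [add_comm, ← measure_sdiff_add_inter C hE, inter_eq_right.2 hEC]
  exact absurd (hClt.trans_le (add_le_add h1 h2.le)) (by rw [h3]; exact lt_irrefl _)

/-- In a set of finite measure which contains an atom `A₀` there are only finitely many sizes of
atoms larger than `A₀`, hence a largest one. -/
theorem exists_max_atom {B E : Set Ω} {r : ℝ≥0∞} (hBfin : m B ≠ ∞)
    (hB : ∀ C, MeasurableSet C → m C ≤ r → m (C \ B) = 0)
    {A₀ : Set Ω} (hA₀E : A₀ ⊆ E) (hA₀ : IsAtomOfMeasure m A₀) (hA₀r : m A₀ ≤ r) :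
    ∃ A ⊆ E, IsAtomOfMeasure m A ∧ m A ≤ r ∧
      ∀ A' ⊆ E, IsAtomOfMeasure m A' → m A' ≤ r → m A' ≤ m A := by
  set V : Set ℝ≥0∞ := {v | m A₀ ≤ v ∧ ∃ A ⊆ E, IsAtomOfMeasure m A ∧ m A ≤ r ∧ m A = v} with hV
  -- Atoms of distinct sizes are almost disjoint, almost contained in `B`, and at least as large as
  -- `A₀`; only finitely many fit into `B`.
  have hVfin : V.Finite := by
    by_contra hinf
    obtain ⟨n, hn⟩ := ENNReal.exists_nat_mul_gt hA₀.2.1 hBfin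
    obtain ⟨F, hFV, hFc⟩ := Set.Infinite.exists_subset_card_eq hinf n
    have hch : ∀ v : ℝ≥0∞, ∃ A, v ∈ F → IsAtomOfMeasure m A ∧ m A ≤ r ∧ m A = v := by
      intro v
      by_cases hv : v ∈ F
      · obtain ⟨-, A, -, h1⟩ := hFV hv
        exact ⟨A, fun _ => h1⟩
      · exact ⟨∅, fun h => absurd h hv⟩
    choose A hA using hch
    have h1 : m (⋃ v ∈ F, A v) = ∑ v ∈ F, m (A v) := by
      refine measure_biUnion_finset₀ ?_ fun v hv => (hA v hv).1.1.nullMeasurableSet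
      intro v hv w hw hvw
      refine (hA v hv).1.inter_null_of_ne (hA w hw).1 ?_
      rwa [(hA v hv).2.2, (hA w hw).2.2]
    have h2 : m (⋃ v ∈ F, A v) ≤ m B := by
      calc m (⋃ v ∈ F, A v) ≤ m (B ∪ ⋃ v ∈ F, A v \ B) := by
            refine measure_mono (iUnion₂_subset fun v hv x hx => ?_)
            by_cases hxB : x ∈ B
            · exact Or.inl hxB
            · exact Or.inr (mem_biUnion (show v ∈ (F : Set ℝ≥0∞) from hv) ⟨hx, hxB⟩)
        _ ≤ m B + m (⋃ v ∈ F, A v \ B) := measure_union_le _ _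
        _ = m B := by
            have h0 : m (⋃ v ∈ F, A v \ B) = 0 :=
              (measure_biUnion_null_iff F.countable_toSet).2 fun v hv =>
                hB (A v) (hA v hv).1.1 (hA v hv).2.1
            rw [h0, add_zero]
    have h3 : n * m A₀ ≤ ∑ v ∈ F, m (A v) := by
      rw [← hFc, ← nsmul_eq_mul]
      refine Finset.card_nsmul_le_sum _ _ _ fun v hv => ?_
      rw [(hA v hv).2.2]
      exact (hFV hv).1
    exact absurd (hn.trans_le h3) (not_lt.2 (h1 ▸ h2))
  obtain ⟨v, ⟨hv, A, hAE, hA, hAr, rfl⟩, hmax⟩ := hVfin.exists_maximalFor id V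
    ⟨m A₀, le_rfl, A₀, hA₀E, hA₀, hA₀r, rfl⟩
  refine ⟨A, hAE, hA, hAr, fun A' hA'E hA' hA'r => ?_⟩
  by_contra hlt
  rw [not_le] at hlt
  refine absurd hlt (not_lt.2 (hmax ⟨?_, A', hA'E, hA', hA'r, rfl⟩ hlt.le))
  exact hv.trans hlt.le

/-- Linearity near `0` in the coarse case: the largest atoms outside of the previous ones form a
sequence which carries all sets of small measure. -/
theorem exists_linear_of_coarse (hcoarse : ∀ T : ℝ≥0∞, T ≠ 0 → T ≠ ∞ → ¬ IsFineBelow m T)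
    (hrange : HasFullRange m) (hm : m univ ≠ 0) (hf : IsAdditiveAlong m f) {ε : ℝ≥0∞} {M : ℝ}
    (hε : ε ≠ 0) (hM : ∀ A, IsAtomOfMeasure m A → m A < ε → |f (m.real A)| ≤ M * m.real A) :
    ∃ T : ℝ, 0 < T ∧ ENNReal.ofReal T ≤ m univ ∧
      ∃ α : ℝ, ∀ x, 0 ≤ x → x ≤ T → f x = α * x := by
  obtain ⟨B, hB, hB1, r₁, hr₁, hnull⟩ :=
    not_isFineBelow_iff.1 (hcoarse 1 one_ne_zero ENNReal.one_ne_top)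
  obtain ⟨r, hr0, hr⟩ := exists_between (a₁ := 0) (a₂ := min (min r₁ ε) 1)
    (lt_min (lt_min (pos_of_ne_zero hr₁) (pos_of_ne_zero hε)) one_pos)
  have hrr₁ : r ≤ r₁ := hr.le.trans ((min_le_left _ _).trans (min_le_left _ _))
  have hrε : r < ε := hr.trans_le ((min_le_left _ _).trans (min_le_right _ _))
  have hrfin : r ≠ ∞ := (hr.trans_le (min_le_right _ _)).ne_top
  have hBfin : m B ≠ ∞ := hB1.ne_top
  have hBr : ∀ C, MeasurableSet C → m C ≤ r → m (C \ B) = 0 := fun C hC hCr =>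
    hnull _ (hC.diff hB) disjoint_sdiff_left ((measure_mono sdiff_subset).trans (hCr.trans hrr₁))
  -- Sets which meet all sufficiently small sets in null sets.
  set R : Set Ω → Prop := fun D => MeasurableSet D ∧
    ∃ c : ℝ≥0∞, c ≠ 0 ∧ ∀ C, MeasurableSet C → m C ≤ c → m (C ∩ D) = 0 with hR
  -- A small nonnull set exists because the range is an interval. It almost avoids `D`, so an atom
  -- outside `D` exists, and hence a largest one of measure at most `r`.
  have hstep : ∀ D : Set Ω, ∃ A, R D → Disjoint A D ∧ IsAtomOfMeasure m A ∧ m A ≤ r ∧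
      ∀ A' ⊆ Dᶜ, IsAtomOfMeasure m A' → m A' ≤ r → m A' ≤ m A := by
    intro D
    by_cases hD : R D
    · obtain ⟨hDm, c, hc, hcD⟩ := hD
      obtain ⟨x, hx0, hx⟩ := exists_between (a₁ := 0) (a₂ := min (min r c) (m univ))
        (lt_min (lt_min hr0 (pos_of_ne_zero hc)) (pos_of_ne_zero hm))
      obtain ⟨C, hC, hCx⟩ := hrange x (hx.le.trans (min_le_right _ _))
      have h1 : m (C \ D) = x := by
        have h2 := measure_sdiff_add_inter (μ := m) C hDm
        rwa [hcD C hC (hCx ▸ hx.le.trans ((min_le_left _ _).trans (min_le_right _ _))), add_zero,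
          hCx] at h2
      have hxr : x ≤ r := hx.le.trans ((min_le_left _ _).trans (min_le_left _ _))
      obtain ⟨A₀, hA₀C, hA₀⟩ := exists_atom_subset hcoarse (hC.diff hDm) (h1 ▸ hx0.ne')
        (h1 ▸ ne_top_of_le_ne_top hrfin hxr)
      obtain ⟨A, hAE, hA, hAr, hmax⟩ := exists_max_atom (E := Dᶜ) hBfin hBr
        (hA₀C.trans fun y hy => hy.2) hA₀ ((measure_mono hA₀C).trans (h1 ▸ hxr))
      exact ⟨A, fun _ => ⟨disjoint_left.2 fun y hy => hAE hy, hA, hAr, hmax⟩⟩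
    · exact ⟨∅, fun h => absurd h hD⟩
  choose g hg using hstep
  have hRn : ∀ n, R (iterUnion g n) := by
    intro n
    induction n with
    | zero => exact ⟨.empty, 1, one_ne_zero, fun C _ _ => by simp [iterUnion]⟩
    | succ n ih =>
      obtain ⟨-, hat, har, -⟩ := hg _ ih
      obtain ⟨hm', c, hc, hcD⟩ := ih
      -- Sets of at most half the measure of the new atom miss it up to a null set.
      refine ⟨hm'.union hat.1, min c (m (g (iterUnion g n)) / 2), ?_, fun C hC hCc => ?_⟩
      · exact (lt_min (pos_of_ne_zero hc) (ENNReal.half_pos hat.2.1)).ne'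
      · rw [iterUnion, inter_union_distrib_left]
        refine measure_union_null (hcD C hC (hCc.trans (min_le_left _ _))) ?_
        rw [inter_comm]
        refine hat.inter_null_of_lt hC (lt_of_le_of_lt (hCc.trans (min_le_right _ _)) ?_)
        exact ENNReal.half_lt_self hat.2.1 (ne_top_of_le_ne_top hrfin har)
  have hat : ∀ n, IsAtomOfMeasure m (g (iterUnion g n)) := fun n => (hg _ (hRn n)).2.1
  have har : ∀ n, m (g (iterUnion g n)) ≤ r := fun n => (hg _ (hRn n)).2.2.1
  have hmax : ∀ n, ∀ A' ⊆ (iterUnion g n)ᶜ, IsAtomOfMeasure m A' → m A' ≤ r →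
      m A' ≤ m (g (iterUnion g n)) := fun n => (hg _ (hRn n)).2.2.2
  have hd := pairwise_disjoint_of_iterUnion fun n => (hg _ (hRn n)).1
  have hUm : MeasurableSet (⋃ n, g (iterUnion g n)) := .iUnion fun n => (hat n).1
  have hU : m (⋃ n, g (iterUnion g n)) ≠ ∞ := by
    refine ne_top_of_le_ne_top hBfin ?_
    calc m (⋃ n, g (iterUnion g n)) ≤ m (⋃ n, g (iterUnion g n) \ B) + m B := by
          refine (measure_mono ?_).trans (measure_union_le _ _)
          rw [← iUnion_sdiff, sdiff_union_self]
          exact subset_union_left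
      _ = m B := by
          rw [measure_iUnion_null fun n => hBr _ (hat n).1 (har n), zero_add]
  have hanti : Antitone fun n => m (g (iterUnion g n)) := by
    refine antitone_nat_of_succ_le fun n => hmax n _ ?_ (hat _) (har _)
    refine subset_trans (disjoint_left.1 (hg _ (hRn (n + 1))).1) ?_
    exact compl_subset_compl.2 (monotone_iterUnion g n.le_succ)
  have hlim : Tendsto (fun n => m (g (iterUnion g n))) atTop (𝓝 0) :=
    ENNReal.tendsto_atTop_zero_of_tsum_ne_top
      (by rwa [← measure_iUnion hd fun n => (hat n).1])
  -- An atom in the residual set would have been a candidate at every stage, so its measure would be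
  -- at most that of every chosen atom, and these tend to zero.
  have hres : ∀ C, MeasurableSet C → m C ≤ r → m (C \ ⋃ n, g (iterUnion g n)) = 0 := by
    intro C hC hCr
    by_contra hne
    have hle : m (C \ ⋃ n, g (iterUnion g n)) ≤ r := (measure_mono sdiff_subset).trans hCr
    obtain ⟨A, hAC, hA⟩ := exists_atom_subset hcoarse (hC.diff hUm) hne
      (ne_top_of_le_ne_top hrfin hle)
    refine hA.2.1 (le_antisymm (ge_of_tendsto' hlim fun n => ?_) zero_le)
    refine hmax n A (hAC.trans fun y hy hy' => hy.2 ?_) hA ((measure_mono hAC).trans hle)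
    exact iterUnion_subset g n hy'
  -- Otherwise take a set whose measure lies strictly between the two. It is too small to meet the
  -- atoms up to `n` in nonnull sets, hence lies almost inside the tail, for which it is too large.
  have htail : ∀ n, m (g (iterUnion g n)) ≤ m (⋃ k ∈ Ici (n + 1), g (iterUnion g k)) := by
    intro n
    by_contra hlt
    obtain ⟨x, hx1, hx2⟩ := exists_between (not_le.1 hlt)
    obtain ⟨C, hC, rfl⟩ := hrange x (hx2.le.trans (measure_mono (subset_univ _)))
    refine absurd hx1 (not_lt.2 ?_)
    have h1 : m (⋃ k ∈ Iic n, g (iterUnion g k) ∩ C) = 0 :=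
      (measure_biUnion_null_iff (to_countable _)).2 fun k hk =>
        (hat k).inter_null_of_lt hC (hx2.trans_le (hanti hk))
    have h2 : C ⊆ (C \ ⋃ n, g (iterUnion g n)) ∪ (⋃ k ∈ Iic n, g (iterUnion g k) ∩ C) ∪
        ⋃ k ∈ Ici (n + 1), g (iterUnion g k) := by
      intro y hy
      by_cases hyU : y ∈ ⋃ n, g (iterUnion g n)
      · obtain ⟨k, hk⟩ := mem_iUnion.1 hyU
        rcases le_or_gt k n with hkn | hkn
        · exact Or.inl (Or.inr (mem_biUnion hkn ⟨hk, hy⟩))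
        · exact Or.inr (mem_biUnion (show k ∈ Ici (n + 1) from hkn) hk)
      · exact Or.inl (Or.inl ⟨hy, hyU⟩)
    refine (measure_mono h2).trans ((measure_union_le _ _).trans ?_)
    rw [measure_union_null (hres C hC (hx2.le.trans (har n))) h1, zero_add]
  have hfin : ∀ n, m (g (iterUnion g n)) ≠ ∞ := fun n => ne_top_of_le_ne_top hrfin (har n)
  obtain ⟨α, hα⟩ := exists_linear_of_disjoint_sequence hf (fun n => (hat n).1) hd hU
    (fun n => ENNReal.toReal_pos (hat n).2.1 (hfin n))
    (fun n => ENNReal.toReal_mono (ne_top_of_le_ne_top hU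
      (measure_mono (iUnion₂_subset fun k _ => subset_iUnion (fun n => g (iterUnion g n)) k)))
      (htail n))
    (fun n => hM _ (hat n) ((har n).trans_lt hrε))
  refine ⟨m.real (⋃ n, g (iterUnion g n)), ?_, ?_, α, hα⟩
  · refine lt_of_lt_of_le (ENNReal.toReal_pos (hat 0).2.1 (hfin 0)) (measureReal_mono ?_ hU)
    exact subset_iUnion (fun n => g (iterUnion g n)) 0
  · rw [measureReal_def, ENNReal.ofReal_toReal hU]
    exact measure_mono (subset_univ _)

/-- Linearity near `0`, from the bound on the small atoms. -/
theorem exists_linear_near_zero (hrange : HasFullRange m) (hm : m univ ≠ 0)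
    (hf : IsAdditiveAlong m f) {ε : ℝ≥0∞} {M : ℝ} (hε : ε ≠ 0)
    (hM : ∀ A, IsAtomOfMeasure m A → m A < ε → |f (m.real A)| ≤ M * m.real A) :
    ∃ T : ℝ, 0 < T ∧ ENNReal.ofReal T ≤ m univ ∧
      ∃ α : ℝ, ∀ x, 0 ≤ x → x ≤ T → f x = α * x := by
  by_cases h : ∀ T : ℝ≥0∞, T ≠ 0 → T ≠ ∞ → ¬ IsFineBelow m T
  · exact exists_linear_of_coarse h hrange hm hf hε hM
  · push Not at h
    obtain ⟨T, h0, hT, hfine⟩ := h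
    exact hfine.exists_linear h0 hT hf

end LevelSets

/-! ### From vanishing near zero to vanishing everywhere. -/

namespace LevelSets

variable {Ω : Type*} [MeasurableSpace Ω] {m : Measure Ω} {f : ℝ → ℝ} {s : ℝ}

theorem IsAdditiveAlong.eq_zero_of_iUnion (hf : IsAdditiveAlong m f)
    {C : ℕ → Set Ω} (hC : ∀ n, MeasurableSet (C n)) (hd : Pairwise (Function.onFun Disjoint C))
    (hfin : m (⋃ n, C n) ≠ ∞) (h0 : ∀ n, f (m.real (C n)) = 0) :
    f (m.real (⋃ n, C n)) = 0 := by
  have h := hf C hC hd hfin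
  simp only [h0] at h
  exact h.unique hasSum_zero

theorem HasFullRange.exists_measureReal_eq (hrange : HasFullRange m) {A : Set Ω}
    (hA : m A ≠ ∞) {x : ℝ} (hx : 0 ≤ x) (hxA : x ≤ m.real A) :
    ∃ C, MeasurableSet C ∧ m C ≠ ∞ ∧ m.real C = x := by
  obtain ⟨C, hC, hCx⟩ := hrange (ENNReal.ofReal x)
    (((ENNReal.ofReal_le_iff_le_toReal hA).2 hxA).trans (measure_mono (subset_univ A)))
  exact ⟨C, hC, by simp [hCx], by rw [measureReal_def, hCx, ENNReal.toReal_ofReal hx]⟩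

/-- If `f` vanishes on the sets of measure less than `s`, a set of measure less than `2 * s` on
which it does not vanish contains an atom on which it does not vanish. -/
theorem exists_atom_ne_zero (hf : IsAdditiveAlong m f)
    (hsmall : ∀ A, MeasurableSet A → m A ≠ ∞ → m.real A < s → f (m.real A) = 0)
    {A : Set Ω} (hA : MeasurableSet A) (hAfin : m A ≠ ∞) (hA2 : m.real A < 2 * s)
    (hfA : f (m.real A) ≠ 0) :
    ∃ b ⊆ A, IsAtomOfMeasure m b ∧ f (m.real b) ≠ 0 := by
  -- Sets of measure below `s` are removed from `A` until none but null ones remain. This does not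
  -- change the value of `f`, and two nonnull pieces of the remainder would together have measure at
  -- least `2 * s`.
  obtain ⟨C, hC, hd, hP, -, hmax⟩ := exists_exhaustion (m := m) hAfin
    (P := fun B C => B ∪ C ⊆ A ∧ m.real C < s)
    (fun B B' C hBB h => ⟨(union_subset_union_left C hBB).trans h.1, h.2⟩)
    (fun B C h => measure_mono h.1)
  have hs : 0 < s := by linarith [measureReal_nonneg (μ := m) (s := A)]
  have hCA : ∀ n, C n ⊆ A := by
    intro n
    rcases hP n with h | h
    · rw [h]; exact empty_subset A
    · exact subset_union_right.trans h.1
  have hCs : ∀ n, m.real (C n) < s := by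
    intro n
    rcases hP n with h | h
    · simpa [h] using hs
    · exact h.2
  have hUA : ⋃ n, C n ⊆ A := iUnion_subset hCA
  have hU : MeasurableSet (⋃ n, C n) := .iUnion hC
  have hfin : ∀ {B}, B ⊆ A → m B ≠ ∞ := fun hB => ne_top_of_le_ne_top hAfin (measure_mono hB)
  have hfU : f (m.real (⋃ n, C n)) = 0 := hf.eq_zero_of_iUnion hC hd (hfin hUA) fun n =>
    hsmall _ (hC n) (hfin (hCA n)) (hCs n)
  set R := A \ ⋃ n, C n with hR
  have hRA : R ⊆ A := sdiff_subset
  have hRm : MeasurableSet R := hA.diff hU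
  have hfR : f (m.real R) ≠ 0 := by
    have h1 := hf.map_union hU hRm disjoint_sdiff_right (hfin hUA) (hfin hRA)
    rw [← measureReal_union disjoint_sdiff_right hRm (hfin hUA) (hfin hRA),
      union_sdiff_cancel hUA, hfU, zero_add] at h1
    rwa [← h1]
  have hnull : ∀ E, MeasurableSet E → E ⊆ R → m.real E < s → m E = 0 := by
    intro E hE hER hEs
    refine hmax E hE (disjoint_sdiff_left.mono_left hER) ⟨?_, hEs⟩
    exact union_subset hUA (hER.trans hRA)
  refine ⟨R, hRA, ⟨hRm, ?_, fun E hE hER => ?_⟩, hfR⟩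
  · intro h0
    rw [measureReal_def, h0] at hfR
    exact hfR hf.map_zero
  · by_contra! hcon
    have h1 : s ≤ m.real E := by
      by_contra h; exact hcon.1 (hnull E hE hER (not_le.1 h))
    have h2 : s ≤ m.real (R \ E) := by
      by_contra h; exact hcon.2 (hnull _ (hRm.diff hE) sdiff_subset (not_le.1 h))
    have h3 := measureReal_union (disjoint_sdiff_right (s := E) (t := R)) (hRm.diff hE)
      (h₁ := hfin (hER.trans hRA)) (h₂ := hfin (sdiff_subset.trans hRA))
    rw [union_sdiff_cancel hER] at h3
    have h4 : m.real R ≤ m.real A := measureReal_mono hRA hAfin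
    linarith

/-- A set of measure `y - m.real b < s` is smaller than the atom, so it is almost disjoint from it,
and it contributes zero. -/
theorem IsAdditiveAlong.eq_of_atom (hf : IsAdditiveAlong m f) (hrange : HasFullRange m)
    (hsmall : ∀ A, MeasurableSet A → m A ≠ ∞ → m.real A < s → f (m.real A) = 0)
    {b : Set Ω} (hb : IsAtomOfMeasure m b) (hbfin : m b ≠ ∞) (hbs : s ≤ m.real b)
    {y : ℝ} (hy : m.real b ≤ y) (hys : y < m.real b + s) : f y = f (m.real b) := by
  obtain ⟨C, hC, hCfin, hCx⟩ := hrange.exists_measureReal_eq hbfin (x := y - m.real b)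
    (by linarith) (by linarith)
  have h1 : m (b ∩ C) = 0 := by
    refine hb.inter_null_of_lt hC ?_
    rw [← ENNReal.toReal_lt_toReal hCfin hbfin, ← measureReal_def, ← measureReal_def]
    linarith
  have h2 := hf.map_union_of_null_inter hb.1 hC h1 hbfin hCfin
  rw [hsmall C hC hCfin (by linarith), hCx, add_zero, add_sub_cancel] at h2
  exact h2

/-- If `f` vanishes on all sets of measure less than `s`, then it vanishes on some set whose measure
lies in `[s, 2 * s)`. -/
theorem IsAdditiveAlong.exists_eq_zero (hf : IsAdditiveAlong m f) (hrange : HasFullRange m)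
    (hs : 0 < s)
    (hsmall : ∀ A, MeasurableSet A → m A ≠ ∞ → m.real A < s → f (m.real A) = 0)
    {A : Set Ω} (hAfin : m A ≠ ∞) (hAs : s ≤ m.real A) :
    ∃ y, s ≤ y ∧ y < 2 * s ∧ f y = 0 := by
  by_cases h : ∃ E F, MeasurableSet E ∧ MeasurableSet F ∧ m E ≠ ∞ ∧ m F ≠ ∞ ∧ m.real E < s ∧
      m.real F < s ∧ s ≤ m.real (E ∪ F)
  · obtain ⟨E, F, hE, hF, hEfin, hFfin, hEs, hFs, hEF⟩ := h
    have hle : m.real (F \ E) ≤ m.real F := measureReal_mono sdiff_subset hFfin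
    have hfin : m (F \ E) ≠ ∞ := ne_top_of_le_ne_top hFfin (measure_mono sdiff_subset)
    have h1 := hf.map_union hE (hF.diff hE) disjoint_sdiff_right hEfin hfin
    rw [hsmall E hE hEfin hEs, hsmall _ (hF.diff hE) hfin (hle.trans_lt hFs), add_zero] at h1
    have h2 := measureReal_union (disjoint_sdiff_right (s := E) (t := F)) (hF.diff hE)
      (h₁ := hEfin) (h₂ := hfin)
    rw [union_sdiff_self] at h2
    exact ⟨_, by linarith, by linarith, h1⟩
  · push Not at h
    -- Here the sets of measure below `s` are closed under finite unions. Sets with measures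
    -- increasing to `s` then have a union of measure exactly `s`, whose disjointed pieces all carry
    -- the value zero.
    have hex : ∀ n : ℕ, ∃ C, MeasurableSet C ∧ m C ≠ ∞ ∧ m.real C = s - s / (n + 1) := by
      intro n
      have h1 : s / (n + 1) ≤ s := div_le_self hs.le (by linarith [n.cast_nonneg (α := ℝ)])
      have h2 : 0 ≤ s / (n + 1) := by positivity
      exact hrange.exists_measureReal_eq hAfin (by linarith) (by linarith)
    choose C hC hCfin hCs using hex
    have hlt : ∀ n, m.real (C n) < s := by
      intro n
      have : 0 < s / (n + 1) := by positivity
      rw [hCs]; linarith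
    have hW : ∀ n, MeasurableSet (accumulate C n) := fun n =>
      .biUnion (to_countable _) fun k _ => hC k
    have hWs : ∀ n, m (accumulate C n) ≠ ∞ ∧ m.real (accumulate C n) < s := by
      intro n
      induction n with
      | zero => simpa using ⟨hCfin 0, hlt 0⟩
      | succ n ih =>
        rw [accumulate_succ]
        refine ⟨(measure_union_lt_top ih.1.lt_top (hCfin _).lt_top).ne, ?_⟩
        exact h _ _ (hW n) (hC _) ih.1 (hCfin _) ih.2 (hlt _)
    have hle : m (⋃ n, C n) ≤ ENNReal.ofReal s := by
      rw [← iUnion_accumulate, monotone_accumulate.measure_iUnion]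
      refine iSup_le fun n => ?_
      rw [ENNReal.le_ofReal_iff_toReal_le (hWs n).1 hs.le]
      exact (hWs n).2.le
    have hfin : m (⋃ n, C n) ≠ ∞ := ne_top_of_le_ne_top ENNReal.ofReal_ne_top hle
    have heq : m.real (⋃ n, C n) = s := by
      refine le_antisymm (ENNReal.toReal_le_of_le_ofReal hs.le hle) ?_
      have h1 : Tendsto (fun n : ℕ => s - s * (1 / ((n : ℝ) + 1))) atTop (𝓝 (s - s * 0)) :=
        (tendsto_one_div_add_atTop_nhds_zero_nat.const_mul s).const_sub s
      rw [mul_zero, sub_zero] at h1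
      refine le_of_tendsto' h1 fun n => ?_
      rw [mul_one_div, ← hCs]
      exact measureReal_mono (subset_iUnion C n) hfin
    refine ⟨s, le_rfl, by linarith, ?_⟩
    rw [← heq, ← iUnion_disjointed]
    refine hf.eq_zero_of_iUnion (fun n => .disjointed hC n) (disjoint_disjointed C)
      (by rwa [iUnion_disjointed]) fun n => ?_
    refine hsmall _ (.disjointed hC n) ?_ ?_
    · exact ne_top_of_le_ne_top (hCfin n) (measure_mono (disjointed_subset C n))
    · exact (measureReal_mono (disjointed_subset C n) (hCfin n)).trans_lt (hlt n)

/-- An additive function which vanishes near `0` vanishes on all sets of finite measure. -/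
theorem IsAdditiveAlong.eq_zero_of_near_zero (hf : IsAdditiveAlong m f) (hrange : HasFullRange m)
    {T : ℝ} (hT : 0 < T) (h0 : ∀ x, 0 ≤ x → x ≤ T → f x = 0)
    {A : Set Ω} (hA : MeasurableSet A) (hAfin : m A ≠ ∞) : f (m.real A) = 0 := by
  by_contra hne
  set X : Set ℝ := {y | ∀ B, MeasurableSet B → m B ≠ ∞ → m.real B ≤ y → f (m.real B) = 0} with hX
  have hTX : T ∈ X := fun B _ _ hBT => h0 _ measureReal_nonneg hBT
  have hbdd : BddAbove X := ⟨m.real A, fun y hy => by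
    by_contra h
    exact hne (hy A hA hAfin (not_le.1 h).le)⟩
  set s := sSup X with hsdef
  have hTs : T ≤ s := le_csSup hbdd hTX
  have hs : 0 < s := hT.trans_le hTs
  have hsmall : ∀ B, MeasurableSet B → m B ≠ ∞ → m.real B < s → f (m.real B) = 0 := by
    intro B hB hBfin hBs
    obtain ⟨y, hy, hBy⟩ := exists_lt_of_lt_csSup ⟨T, hTX⟩ hBs
    exact hy B hB hBfin hBy.le
  have hAs : s ≤ m.real A := by
    by_contra h
    exact hne (hsmall A hA hAfin (not_le.1 h))
  -- By the choice of `s`, `f` fails to vanish on sets of measure at most any level above `s`. The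
  -- cap `3 / 2 * s` keeps these below `2 * s`, so that an atom can be extracted.
  have hatom : ∀ y, s < y → ∃ b, IsAtomOfMeasure m b ∧ m b ≠ ∞ ∧ f (m.real b) ≠ 0 ∧
      s ≤ m.real b ∧ m.real b ≤ y ∧ m.real b < 2 * s := by
    intro y hy
    have hy' : min y (3 / 2 * s) ∉ X := fun hmem => by
      have h1 : s < min y (3 / 2 * s) := lt_min hy (by linarith)
      exact absurd (le_csSup hbdd hmem) (not_le.2 h1)
    simp only [hX, mem_ofPred_eq] at hy'
    push Not at hy'
    obtain ⟨B, hB, hBfin, hBy, hBne⟩ := hy'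
    have hB2 : m.real B < 2 * s := by linarith [min_le_right y (3 / 2 * s)]
    obtain ⟨b, hbB, hb, hbne⟩ := exists_atom_ne_zero hf hsmall hB hBfin hB2 hBne
    have hbfin : m b ≠ ∞ := ne_top_of_le_ne_top hBfin (measure_mono hbB)
    have hle : m.real b ≤ m.real B := measureReal_mono hbB hBfin
    refine ⟨b, hb, hbfin, hbne, ?_, hle.trans (hBy.trans (min_le_left _ _)), hle.trans_lt hB2⟩
    by_contra h
    exact hbne (hsmall b hb.1 hbfin (not_le.1 h))
  by_cases hex : ∃ b, IsAtomOfMeasure m b ∧ m b ≠ ∞ ∧ f (m.real b) ≠ 0 ∧ m.real b = s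
  -- An atom of measure exactly `s` would make `f` constant and nonzero on `[s, 2 * s)`.
  · obtain ⟨b, hb, hbfin, hbne, hbs⟩ := hex
    obtain ⟨y, hy1, hy2, hy3⟩ := hf.exists_eq_zero hrange hs hsmall hAfin hAs
    refine hbne ?_
    rw [← hy3]
    exact (hf.eq_of_atom hrange hsmall hb hbfin hbs.ge (by linarith) (by linarith)).symm
  · have hgt : ∀ b, IsAtomOfMeasure m b → m b ≠ ∞ → f (m.real b) ≠ 0 → s ≤ m.real b →
        s < m.real b := fun b h1 h2 h3 h4 =>
      lt_of_le_of_ne h4 fun h => hex ⟨b, h1, h2, h3, h.symm⟩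
    -- Three atoms with `s < m b₁ < m b₂ < m b₃ < 2 * s` share one value of `f`. The midpoints
    -- ensure `m b₃ ≤ m b₁ + m b₂ < m b₃ + s`, so the almost disjoint union of `b₁` and `b₂` has
    -- this value too; being also its double, it is zero.
    obtain ⟨b₃, hb₃, hfin₃, hne₃, hs₃, -, hlt₃⟩ := hatom (2 * s) (by linarith)
    have hgt₃ := hgt b₃ hb₃ hfin₃ hne₃ hs₃
    obtain ⟨b₂, hb₂, hfin₂, hne₂, hs₂, hle₂, hlt₂⟩ := hatom ((s + m.real b₃) / 2) (by linarith)
    have hgt₂ := hgt b₂ hb₂ hfin₂ hne₂ hs₂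
    obtain ⟨b₁, hb₁, hfin₁, hne₁, hs₁, hle₁, hlt₁⟩ := hatom ((s + m.real b₂) / 2) (by linarith)
    have h23 := hf.eq_of_atom hrange hsmall hb₂ hfin₂ hs₂ (y := m.real b₃) (by linarith)
      (by linarith)
    have h13 := hf.eq_of_atom hrange hsmall hb₁ hfin₁ hs₁ (y := m.real b₃) (by linarith)
      (by linarith)
    have hsum := hf.eq_of_atom hrange hsmall hb₃ hfin₃ hs₃ (y := m.real b₁ + m.real b₂)
      (by linarith) (by linarith)
    have hnull : m (b₁ ∩ b₂) = 0 := hb₁.inter_null_of_ne hb₂ fun h => by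
      have : m.real b₁ = m.real b₂ := by rw [measureReal_def, h, measureReal_def]
      linarith
    rw [hf.map_union_of_null_inter hb₁.1 hb₂.1 hnull hfin₁ hfin₂] at hsum
    exact hne₃ (by linarith)

/-- A function which is additive along a measure whose range is an interval is linear, provided
that its quotients on small atoms are bounded. -/
theorem IsAdditiveAlong.exists_linear (hf : IsAdditiveAlong m f) (hrange : HasFullRange m)
    {ε : ℝ≥0∞} {M : ℝ} (hε : ε ≠ 0)
    (hM : ∀ A, IsAtomOfMeasure m A → m A < ε → |f (m.real A)| ≤ M * m.real A) :
    ∃ α : ℝ, ∀ A, MeasurableSet A → m A ≠ ∞ → f (m.real A) = α * m.real A := by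
  by_cases hm : m univ = 0
  · refine ⟨0, fun A _ _ => ?_⟩
    rw [measureReal_def, measure_mono_null (subset_univ A) hm]
    simpa using hf.map_zero
  obtain ⟨T, hT, -, α, hα⟩ := exists_linear_near_zero hrange hm hf hε hM
  refine ⟨α, fun A hA hAfin => ?_⟩
  have := (hf.sub_linear α).eq_zero_of_near_zero hrange hT
    (fun x hx hxT => by rw [hα x hx hxT, sub_self]) hA hAfin
  linarith

end LevelSets

/-! ### Total variation and Hahn decomposition of extended real valued measures. -/

namespace LevelSets

variable {Ω : Type*} [MeasurableSpace Ω] {μ ν : VectorMeasure Ω EReal}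

theorem hasSum_toReal {ι : Type*} {g : ι → EReal} {a : EReal} (h : HasSum g a)
    (hg : ∀ i, g i ≠ ⊤ ∧ g i ≠ ⊥) (ha : a ≠ ⊤ ∧ a ≠ ⊥) :
    HasSum (fun i => (g i).toReal) a.toReal := by
  let c : ℝ →+ EReal := ⟨⟨fun x => (x : EReal), EReal.coe_zero⟩, EReal.coe_add⟩
  have hc : IsInducing c := EReal.isEmbedding_coe.isInducing
  refine (hc.hasSum_iff (fun i => (g i).toReal) a.toReal).1 ?_
  have h1 : c ∘ (fun i => (g i).toReal) = g := by
    funext i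
    exact EReal.coe_toReal (hg i).1 (hg i).2
  have h2 : c a.toReal = a := EReal.coe_toReal ha.1 ha.2
  rwa [h1, h2]

/-- Multiplication by a nonzero real is continuous even at `±∞`. Finiteness of the terms reduces
distributivity over partial sums to the real case. -/
theorem hasSum_coe_mul {ι : Type*} {g : ι → EReal} {a : EReal} (h : HasSum g a)
    (hg : ∀ i, g i ≠ ⊤ ∧ g i ≠ ⊥) {α : ℝ} (hα : α ≠ 0) :
    HasSum (fun i => (α : EReal) * g i) (α * a) := by
  have hcont : ContinuousAt (fun x : EReal => (α : EReal) * x) a := by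
    have h1 : ContinuousAt (fun p : EReal × EReal => p.1 * p.2) ((α : EReal), a) :=
      EReal.continuousAt_mul (by simp [hα]) (by simp [hα]) (by simp) (by simp)
    exact h1.comp (f := fun x : EReal => ((α : EReal), x)) (by fun_prop)
  have h2 := hcont.tendsto.comp h
  refine h2.congr fun F => ?_
  have h3 : ∑ i ∈ F, g i = ((∑ i ∈ F, (g i).toReal : ℝ) : EReal) ∧
      ∑ i ∈ F, (α : EReal) * g i = ((α * ∑ i ∈ F, (g i).toReal : ℝ) : EReal) := by
    classical
    induction F using Finset.induction_on with
    | empty => simp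
    | insert i F hi ih =>
      rw [Finset.sum_insert hi, Finset.sum_insert hi, Finset.sum_insert hi, ih.1, ih.2, mul_add]
      rw [← EReal.coe_toReal (hg i).1 (hg i).2]
      simp only [EReal.coe_add, EReal.coe_mul, EReal.toReal_coe, and_self]
  simp only [Function.comp]
  rw [h3.1, h3.2, EReal.coe_mul]

theorem abs_add_of_nonneg {x y : EReal} (hx : 0 ≤ x) (hy : 0 ≤ y) :
    (x + y).abs = x.abs + y.abs := by
  rw [← EReal.coe_toENNReal hx, ← EReal.coe_toENNReal hy, ← EReal.coe_ennreal_add]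
  have h : ∀ z : ℝ≥0∞, (z : EReal).abs = z := by
    intro z
    rw [abs_eq_max, EReal.toENNReal_coe, max_eq_left]
    rw [EReal.toENNReal_of_nonpos (EReal.neg_le_zero.2 (EReal.coe_ennreal_nonneg z))]
    exact zero_le
  rw [h, h, h]

theorem abs_add_of_nonpos {x y : EReal} (hx : x ≤ 0) (hy : y ≤ 0) :
    (x + y).abs = x.abs + y.abs := by
  have hx' : x ≠ ⊤ := (hx.trans_lt EReal.zero_lt_top).ne
  have hy' : y ≠ ⊤ := (hy.trans_lt EReal.zero_lt_top).ne
  rw [← EReal.abs_neg, EReal.neg_add (Or.inr hy') (Or.inl hx'), sub_eq_add_neg,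
    abs_add_of_nonneg (EReal.neg_nonneg.2 hx) (EReal.neg_nonneg.2 hy), EReal.abs_neg,
    EReal.abs_neg]

theorem coe_abs_of_nonneg {x : EReal} (hx : 0 ≤ x) : (x.abs : EReal) = x := by
  induction x with
  | bot => exact absurd hx (by simp)
  | top => simp
  | coe x => rw [EReal.coe_abs, abs_of_nonneg (EReal.coe_nonneg.1 hx)]

theorem coe_abs_of_nonpos {x : EReal} (hx : x ≤ 0) : (x.abs : EReal) = -x := by
  rw [← EReal.abs_neg, coe_abs_of_nonneg (EReal.neg_nonneg.2 hx)]

theorem abs_ne_top_iff {x : EReal} : x.abs ≠ ∞ ↔ x ≠ ⊤ ∧ x ≠ ⊥ := by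
  induction x with
  | bot => simp
  | top => simp
  | coe x => simp [EReal.abs_def]

theorem variation_apply {A : Set Ω} (hA : MeasurableSet A) :
    variation μ A = preVariationFun (fun A => (μ A).abs) A := by
  rw [variation, preVariation_apply, VectorMeasure.ennrealToMeasure_apply hA,
    ennrealPreVariation_apply]

theorem abs_le_variation {A : Set Ω} (hA : MeasurableSet A) : (μ A).abs ≤ variation μ A := by
  rw [variation_apply hA]
  by_cases h0 : A = ∅
  · simp [h0]
  have hne : (⟨A, hA⟩ : Subtype MeasurableSet) ≠ ⊥ := fun h => h0 (congrArg Subtype.val h)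
  have h := preVariation.sum_le (fun A => (μ A).abs) hA (Finpartition.indiscrete hne)
  simpa using h

theorem ne_top_of_variation {A : Set Ω} (hA : MeasurableSet A) (h : variation μ A ≠ ∞) :
    μ A ≠ ⊤ ∧ μ A ≠ ⊥ :=
  abs_ne_top_iff.1 (ne_top_of_le_ne_top h (abs_le_variation hA))

/-- If `|μ|` adds over disjoint subsets of `A`, all partitions give the same sum. This applies to
the two sides of a Hahn decomposition. -/
theorem variation_eq_abs {A : Set Ω} (hA : MeasurableSet A)
    (hadd : ∀ B C, MeasurableSet B → MeasurableSet C → B ⊆ A → C ⊆ A → Disjoint B C →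
      (μ (B ∪ C)).abs = (μ B).abs + (μ C).abs) : variation μ A = (μ A).abs := by
  refine le_antisymm ?_ (abs_le_variation hA)
  rw [variation_apply hA, preVariationFun_apply _ hA]
  refine iSup_le fun P => le_of_eq ?_
  classical
  have key : ∀ F : Finset (Subtype (MeasurableSet (α := Ω))), F ⊆ P.parts →
      ((F.sup id : Subtype (MeasurableSet (α := Ω))) : Set Ω) ⊆ A ∧
      ∑ p ∈ F, (μ p).abs = (μ ((F.sup id : Subtype (MeasurableSet (α := Ω))) : Set Ω)).abs := by
    intro F
    induction F using Finset.induction_on with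
    | empty => intro _; simp
    | insert p F hp ih =>
      intro hF
      have hpP : p ∈ P.parts := hF (Finset.mem_insert_self p F)
      have hFP : F ⊆ P.parts := (Finset.subset_insert p F).trans hF
      obtain ⟨ih1, ih2⟩ := ih hFP
      have hpA : (p : Set Ω) ⊆ A := P.le hpP
      have hdis : Disjoint (p : Set Ω) ((F.sup id : Subtype (MeasurableSet (α := Ω))) : Set Ω) := by
        have h1 : Disjoint p (F.sup id) := P.supIndep hFP hpP hp
        rw [Set.disjoint_iff_inter_eq_empty]
        exact congrArg Subtype.val (disjoint_iff.1 h1)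
      rw [Finset.sum_insert hp, ih2, Finset.sup_insert]
      refine ⟨union_subset hpA ih1, ?_⟩
      exact (hadd _ _ p.2 (F.sup id).2 hpA ih1 hdis).symm
  have h := (key P.parts subset_rfl).2
  rw [P.sup_parts] at h
  exact h

/-- The real valued measure obtained by restricting an extended real valued measure to a set of
finite variation. -/
noncomputable def toSignedMeasureOn (μ : VectorMeasure Ω EReal) (S : Set Ω)
    (hS : MeasurableSet S) (hfin : variation μ S ≠ ∞) : SignedMeasure Ω := by
  classical
  exact
  { measureOf' := fun A => if MeasurableSet A then (μ (A ∩ S)).toReal else 0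
    empty' := by simp
    not_measurable' := fun A hA => by simp [hA]
    m_iUnion' := fun A hA hd => by
      have hf : ∀ B, MeasurableSet B → μ (B ∩ S) ≠ ⊤ ∧ μ (B ∩ S) ≠ ⊥ := fun B hB =>
        ne_top_of_variation (hB.inter hS)
          (ne_top_of_le_ne_top hfin (measure_mono inter_subset_right))
      simp only [hA, MeasurableSet.iUnion hA, if_true]
      refine hasSum_toReal ?_ (fun i => hf _ (hA i)) (hf _ (.iUnion hA))
      rw [iUnion_inter]
      exact μ.m_iUnion (fun i => (hA i).inter hS)
        fun i j hij => (hd hij).mono inter_subset_left inter_subset_left }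

theorem toSignedMeasureOn_apply {S : Set Ω} (hS : MeasurableSet S) (hfin : variation μ S ≠ ∞)
    {A : Set Ω} (hA : MeasurableSet A) (hAS : A ⊆ S) :
    (toSignedMeasureOn μ S hS hfin A : EReal) = μ A := by
  have h1 : toSignedMeasureOn μ S hS hfin A = (μ A).toReal := by
    have : toSignedMeasureOn μ S hS hfin A =
      @ite _ (MeasurableSet A) (Classical.propDecidable _) (μ (A ∩ S)).toReal 0 := rfl
    rw [this, if_pos hA, inter_eq_left.2 hAS]
  have h2 := ne_top_of_variation hA (ne_top_of_le_ne_top hfin (measure_mono hAS))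
  rw [h1, EReal.coe_toReal h2.1 h2.2]

/-- The Hahn decomposition of a measure whose variation is `σ`-finite. -/
theorem exists_hahn (hμ : SigmaFinite (variation μ)) :
    ∃ P, MeasurableSet P ∧ (∀ A, MeasurableSet A → A ⊆ P → 0 ≤ μ A) ∧
      ∀ A, MeasurableSet A → A ⊆ Pᶜ → μ A ≤ 0 := by
  set S := disjointed (spanningSets (variation μ)) with hS
  have hSm : ∀ n, MeasurableSet (S n) := fun n =>
    .disjointed (measurableSet_spanningSets (variation μ)) n
  have hSd : Pairwise (Function.onFun Disjoint S) := disjoint_disjointed _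
  have hSU : ⋃ n, S n = univ := by rw [hS, iUnion_disjointed, iUnion_spanningSets]
  have hSfin : ∀ n, variation μ (S n) ≠ ∞ := fun n =>
    ((measure_mono (disjointed_subset _ n)).trans_lt
      (measure_spanningSets_lt_top (variation μ) n)).ne
  -- Real signed measures have Hahn decompositions; those on the disjoint pieces of finite variation
  -- are glued together.
  choose I hI hpos hneg using fun n =>
    (toSignedMeasureOn μ (S n) (hSm n) (hSfin n)).exists_compl_positive_negative
  have hsum : ∀ A, MeasurableSet A → HasSum (fun n => μ (A ∩ S n)) (μ A) := by
    intro A hA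
    have h := μ.m_iUnion (f := fun n => A ∩ S n) (fun n => hA.inter (hSm n))
      fun i j hij => (hSd hij).mono inter_subset_right inter_subset_right
    rwa [← inter_iUnion, hSU, inter_univ] at h
  have hP : ∀ n x, x ∈ S n → (x ∈ ⋃ k, I k ∩ S k) → x ∈ I n := by
    intro n x hx hxP
    obtain ⟨k, hk, hk'⟩ := mem_iUnion.1 hxP
    by_cases hkn : k = n
    · rwa [← hkn]
    · exact absurd hx (disjoint_left.1 (hSd hkn) hk')
  refine ⟨⋃ k, I k ∩ S k, .iUnion fun k => (hI k).inter (hSm k), fun A hA hAP => ?_,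
    fun A hA hAP => ?_⟩
  · refine (hsum A hA).nonneg fun n => ?_
    rw [← toSignedMeasureOn_apply (hSm n) (hSfin n) (hA.inter (hSm n)) inter_subset_right]
    have h := VectorMeasure.subset_le_of_restrict_le_restrict _ _ (hI n) (hpos n)
      (j := A ∩ S n) fun x hx => hP n x hx.2 (hAP hx.1)
    exact EReal.coe_nonneg.2 h
  · refine hasSum_le (fun n => ?_) (hsum A hA) hasSum_zero
    rw [← toSignedMeasureOn_apply (hSm n) (hSfin n) (hA.inter (hSm n)) inter_subset_right]
    have h := VectorMeasure.subset_le_of_restrict_le_restrict _ _ (hI n).compl (hneg n)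
      (j := A ∩ S n) fun x hx hxI => hAP hx.1 (mem_iUnion.2 ⟨n, hxI, hx.2⟩)
    exact EReal.coe_nonpos.2 h

/-- A Hahn decomposition whose part `Q` has finite measure: `μ` is `e * m` outside of `Q` and
`-e * m` on `Q`, where `e` is a sign and `m` the variation of `μ`. -/
structure IsHahnPair (μ : VectorMeasure Ω EReal) (m : Measure Ω) (e : ℝ) (Q : Set Ω) : Prop where
  sign : e = 1 ∨ e = -1
  meas : MeasurableSet Q
  finite : m Q ≠ ∞
  compl : ∀ A, MeasurableSet A → A ⊆ Qᶜ → μ A = (e : EReal) * (m A : EReal)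
  self : ∀ A, MeasurableSet A → A ⊆ Q → μ A = ((-e : ℝ) : EReal) * (m A : EReal)

theorem IsSigmaFiniteSignedMeasure.exists_hahnPair (hμ : IsSigmaFiniteSignedMeasure μ) :
    ∃ e Q, IsHahnPair μ (variation μ) e Q := by
  obtain ⟨P, hP, hpos, hneg⟩ := exists_hahn hμ.2
  have hvpos : ∀ A, MeasurableSet A → A ⊆ P → (variation μ A : EReal) = μ A := by
    intro A hA hAP
    rw [variation_eq_abs hA, coe_abs_of_nonneg (hpos A hA hAP)]
    intro B C hB hC hBA hCA hBC
    rw [μ.of_union hBC hB hC, abs_add_of_nonneg (hpos B hB (hBA.trans hAP))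
      (hpos C hC (hCA.trans hAP))]
  have hvneg : ∀ A, MeasurableSet A → A ⊆ Pᶜ → (variation μ A : EReal) = -μ A := by
    intro A hA hAP
    rw [variation_eq_abs hA, coe_abs_of_nonpos (hneg A hA hAP)]
    intro B C hB hC hBA hCA hBC
    rw [μ.of_union hBC hB hC, abs_add_of_nonpos (hneg B hB (hBA.trans hAP))
      (hneg C hC (hCA.trans hAP))]
  -- The side whose sign belongs to the omitted infinite value has finite variation and becomes `Q`.
  rcases hμ.1 with h | h
  · refine ⟨-1, P, Or.inr rfl, hP, ?_, fun A hA hAP => ?_, fun A hA hAP => ?_⟩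
    · intro htop
      have := hvpos P hP subset_rfl
      rw [htop] at this
      exact h P this.symm
    · rw [hvneg A hA hAP]; simp
    · rw [hvpos A hA hAP]; simp
  · refine ⟨1, Pᶜ, Or.inl rfl, hP.compl, ?_, fun A hA hAP => ?_, fun A hA hAP => ?_⟩
    · intro htop
      have h1 := hvneg Pᶜ hP.compl subset_rfl
      rw [htop] at h1
      refine h Pᶜ ?_
      rw [← EReal.neg_eq_top_iff, ← h1]
      rfl
    · rw [compl_compl] at hAP
      rw [hvpos A hA hAP]; simp
    · rw [hvneg A hA hAP]; simp

end LevelSets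

/-! ### Reduction from `μ` and `ν` to the variation and one real function. -/

namespace LevelSets

variable {Ω : Type*} [MeasurableSpace Ω] {μ ν : VectorMeasure Ω EReal}

theorem coe_measureReal {m : Measure Ω} {A : Set Ω} (hA : m A ≠ ∞) :
    ((m.real A : ℝ) : EReal) = (m A : EReal) := by
  rw [measureReal_def]
  lift m A to NNReal using hA with a
  rfl

namespace IsHahnPair

variable {m : Measure Ω} {e : ℝ} {Q : Set Ω}

theorem add_inter {A : Set Ω} (v : VectorMeasure Ω EReal) (h : IsHahnPair μ m e Q)
    (hA : MeasurableSet A) : v A = v (A ∩ Qᶜ) + v (A ∩ Q) := by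
  rw [← v.of_union (disjoint_compl_left.mono inter_subset_right inter_subset_right)
    (hA.inter h.meas.compl) (hA.inter h.meas), ← inter_union_distrib_left, compl_union_self,
    inter_univ]

theorem finite_of_subset (h : IsHahnPair μ m e Q) {A : Set Ω} (hA : MeasurableSet A)
    (hAfin : m A ≠ ∞) : μ A ≠ ⊤ ∧ μ A ≠ ⊥ := by
  have hf : ∀ {B}, B ⊆ A → m B ≠ ∞ := fun hB => ne_top_of_le_ne_top hAfin (measure_mono hB)
  rw [h.add_inter μ hA, h.compl _ (hA.inter h.meas.compl) inter_subset_right,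
    h.self _ (hA.inter h.meas) inter_subset_right]
  lift m (A ∩ Qᶜ) to NNReal using hf inter_subset_left with a
  lift m (A ∩ Q) to NNReal using hf inter_subset_left with b
  have h1 : (e : EReal) * ((a : ℝ≥0∞) : EReal) + ((-e : ℝ) : EReal) * ((b : ℝ≥0∞) : EReal) =
      ((e * a + -e * b : ℝ) : EReal) := by
    push_cast
    rfl
  rw [h1]
  exact ⟨EReal.coe_ne_top _, EReal.coe_ne_bot _⟩

/-- Passing to `A ∆ Q` adds the part of `A` outside `Q` and removes the part inside, where `μ` has
the opposite sign; both change `μ Q` by `e * m`. Finiteness on `Q` keeps the cancellation legitimate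
when `m A = ∞`. -/
theorem apply_symmDiff (h : IsHahnPair μ m e Q) {A : Set Ω} (hA : MeasurableSet A) :
    μ (symmDiff A Q) = (e : EReal) * (m A : EReal) + μ Q := by
  have hf : ∀ {B}, B ⊆ Q → m B ≠ ∞ := fun hB => ne_top_of_le_ne_top h.finite (measure_mono hB)
  have h1 : symmDiff A Q = (A ∩ Qᶜ) ∪ (Q \ A) := rfl
  have h2 : m A = m (A ∩ Qᶜ) + m (A ∩ Q) := by
    rw [add_comm]; exact (measure_inter_add_sdiff A h.meas).symm
  have h3 : m Q = m (A ∩ Q) + m (Q \ A) := by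
    rw [inter_comm]; exact (measure_inter_add_sdiff Q hA).symm
  rw [h1, μ.of_union (disjoint_left.2 fun x hx hx' => hx.2 hx'.1) (hA.inter h.meas.compl)
    (h.meas.diff hA), h.compl _ (hA.inter h.meas.compl) inter_subset_right,
    h.self _ (h.meas.diff hA) sdiff_subset, h.self Q h.meas subset_rfl, h2, h3]
  lift m (A ∩ Q) to NNReal using hf inter_subset_right with b
  lift m (Q \ A) to NNReal using hf sdiff_subset with c
  rcases eq_or_ne (m (A ∩ Qᶜ)) ∞ with ha | ha
  · rw [ha]
    have h4 : ∀ x : ℝ, ((x : ℝ) : EReal) * ((c : ℝ≥0∞) : EReal) = ((x * c : ℝ) : EReal) := by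
      intro x; push_cast; rfl
    have h5 : ∀ x : ℝ, ((x : ℝ) : EReal) * (((b : ℝ≥0∞) + (c : ℝ≥0∞) : ℝ≥0∞) : EReal) =
        ((x * (b + c) : ℝ) : EReal) := by
      intro x; push_cast; rfl
    rw [h4, h5, top_add, EReal.coe_ennreal_top]
    rcases h.sign with rfl | rfl
    · rw [EReal.coe_mul_top_of_pos one_pos, EReal.top_add_coe, EReal.top_add_coe]
    · rw [EReal.coe_mul_top_of_neg (by norm_num), EReal.bot_add, EReal.bot_add]
  · lift m (A ∩ Qᶜ) to NNReal using ha with a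
    have h4 : (e : EReal) * ((a : ℝ≥0∞) : EReal) + ((-e : ℝ) : EReal) * ((c : ℝ≥0∞) : EReal) =
        ((e * a + -e * c : ℝ) : EReal) := by push_cast; rfl
    have h5 : (e : EReal) * (((a : ℝ≥0∞) + (b : ℝ≥0∞) : ℝ≥0∞) : EReal) +
        ((-e : ℝ) : EReal) * (((b : ℝ≥0∞) + (c : ℝ≥0∞) : ℝ≥0∞) : EReal) =
        ((e * (a + b) + -e * (b + c) : ℝ) : EReal) := by push_cast; rfl
    rw [h4, h5]
    congr 1
    ring

/-- The range of `μ` is that of `m`, reflected if `e = -1` and shifted by the finite number `μ Q`.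
-/
theorem hasFullRange (h : IsHahnPair μ m e Q) (hrange : (measureRange μ).OrdConnected) :
    HasFullRange m := by
  have hQ := h.finite_of_subset h.meas h.finite
  obtain ⟨q, hq⟩ : ∃ q : ℝ, μ Q = q := ⟨_, (EReal.coe_toReal hQ.1 hQ.2).symm⟩
  intro x hx
  have hmem : (e : EReal) * (x : EReal) + μ Q ∈ measureRange μ := by
    have h0 : μ Q ∈ measureRange μ := ⟨Q, h.meas, rfl⟩
    have h1 : (e : EReal) * (m univ : EReal) + μ Q ∈ measureRange μ :=
      ⟨symmDiff univ Q, MeasurableSet.univ.symmDiff h.meas, h.apply_symmDiff .univ⟩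
    have hx' : (x : EReal) ≤ (m univ : EReal) := EReal.coe_ennreal_le_coe_ennreal_iff.2 hx
    have hx0 : (0 : EReal) ≤ (x : EReal) := EReal.coe_ennreal_nonneg x
    rcases h.sign with rfl | rfl
    · refine hrange.out h0 h1 ⟨?_, ?_⟩
      · rw [EReal.coe_one, one_mul]
        simpa using add_le_add_left hx0 (μ Q)
      · rw [EReal.coe_one, one_mul, one_mul]
        exact add_le_add_left hx' (μ Q)
    · refine hrange.out h1 h0 ⟨?_, ?_⟩
      · simp only [EReal.coe_neg, EReal.coe_one, neg_mul, one_mul]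
        exact add_le_add_left (EReal.neg_le_neg_iff.2 hx') (μ Q)
      · simp only [EReal.coe_neg, EReal.coe_one, neg_mul, one_mul]
        simpa using add_le_add_left (EReal.neg_le_zero.2 hx0) (μ Q)
  obtain ⟨C, hC, hCx⟩ := hmem
  refine ⟨symmDiff C Q, hC.symmDiff h.meas, ?_⟩
  have h1 := h.apply_symmDiff (hC.symmDiff h.meas)
  rw [symmDiff_symmDiff_cancel_right, hCx, hq] at h1
  have h2 : (e : EReal) * (x : EReal) = (e : EReal) * (m (symmDiff C Q) : EReal) := by
    have := congrArg (fun y => y - (q : EReal)) h1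
    simpa only [EReal.add_sub_cancel_right] using this
  rcases h.sign with rfl | rfl
  · rw [EReal.coe_one, one_mul, one_mul] at h2
    exact (EReal.coe_ennreal_injective h2).symm
  · simp only [EReal.coe_neg, EReal.coe_one, neg_mul, one_mul, neg_inj] at h2
    exact (EReal.coe_ennreal_injective h2).symm

end IsHahnPair

/-- The set function which corresponds to the variation of `μ` as `ν` corresponds to `μ`. -/
noncomputable def signedPart (ν : VectorMeasure Ω EReal) (e : ℝ) (Q A : Set Ω) : ℝ :=
  e * ((ν (A ∩ Qᶜ)).toReal - (ν (A ∩ Q)).toReal)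

namespace IsHahnPair

variable {m : Measure Ω} {e : ℝ} {Q : Set Ω}

theorem finite_right (h : IsHahnPair μ m e Q) (hL : SatisfiesL μ ν) {A : Set Ω}
    (hA : MeasurableSet A) (hAfin : m A ≠ ∞) : ν A ≠ ⊤ ∧ ν A ≠ ⊥ :=
  have h1 := h.finite_of_subset hA hAfin
  (hL A A hA hA rfl h1.1 h1.2).2

theorem signedPart_eq (h : IsHahnPair μ m e Q) (hL : SatisfiesL μ ν) {A : Set Ω}
    (hA : MeasurableSet A) (hAfin : m A ≠ ∞) :
    signedPart ν e Q A = e * ((ν (symmDiff A Q)).toReal - (ν Q).toReal) := by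
  have hfA : ∀ {B}, MeasurableSet B → B ⊆ A → ν B ≠ ⊤ ∧ ν B ≠ ⊥ := fun hB hBA =>
    h.finite_right hL hB (ne_top_of_le_ne_top hAfin (measure_mono hBA))
  have hfQ : ∀ {B}, MeasurableSet B → B ⊆ Q → ν B ≠ ⊤ ∧ ν B ≠ ⊥ := fun hB hBQ =>
    h.finite_right hL hB (ne_top_of_le_ne_top h.finite (measure_mono hBQ))
  have h1 : symmDiff A Q = (A ∩ Qᶜ) ∪ (Q \ A) := rfl
  have f1 := hfA (hA.inter h.meas.compl) inter_subset_left
  have f2 := hfA (hA.inter h.meas) inter_subset_left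
  have f3 := hfQ (h.meas.diff hA) sdiff_subset
  have h2 : ν Q = ν (A ∩ Q) + ν (Q \ A) := by
    rw [← ν.of_union (disjoint_left.2 fun x hx hx' => hx'.2 hx.1) (hA.inter h.meas)
      (h.meas.diff hA), inter_comm, inter_union_sdiff]
  rw [h1, ν.of_union (disjoint_left.2 fun x hx hx' => hx.2 hx'.1) (hA.inter h.meas.compl)
    (h.meas.diff hA), h2, EReal.toReal_add f1.1 f1.2 f3.1 f3.2,
    EReal.toReal_add f2.1 f2.2 f3.1 f3.2, signedPart]
  ring

/-- Sets with equal `m` have symmetric differences with `Q` of equal finite `μ`, to which (L)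
applies. -/
theorem signedPart_congr (h : IsHahnPair μ m e Q) (hL : SatisfiesL μ ν) {A B : Set Ω}
    (hA : MeasurableSet A) (hB : MeasurableSet B) (hAfin : m A ≠ ∞) (hAB : m A = m B) :
    signedPart ν e Q A = signedPart ν e Q B := by
  have hfin : m (symmDiff A Q) ≠ ∞ := by
    refine ne_top_of_le_ne_top (ENNReal.add_ne_top.2 ⟨hAfin, h.finite⟩)
      ((measure_mono ?_).trans (measure_union_le A Q))
    exact symmDiff_le_sup
  have h1 := h.finite_of_subset (hA.symmDiff h.meas) hfin
  rw [h.signedPart_eq hL hA hAfin, h.signedPart_eq hL hB (hAB ▸ hAfin),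
    (hL _ _ (hA.symmDiff h.meas) (hB.symmDiff h.meas)
      (by rw [h.apply_symmDiff hA, h.apply_symmDiff hB, hAB]) h1.1 h1.2).1]

theorem exists_function (h : IsHahnPair μ m e Q) (hL : SatisfiesL μ ν) :
    ∃ f : ℝ → ℝ, ∀ A, MeasurableSet A → m A ≠ ∞ → f (m.real A) = signedPart ν e Q A := by
  have hex : ∀ x : ℝ, ∃ y : ℝ, ∀ A, MeasurableSet A → m A ≠ ∞ → m.real A = x →
      y = signedPart ν e Q A := by
    intro x
    by_cases hx : ∃ A, MeasurableSet A ∧ m A ≠ ∞ ∧ m.real A = x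
    · obtain ⟨A, hA, hAfin, rfl⟩ := hx
      refine ⟨signedPart ν e Q A, fun B hB hBfin hBA => h.signedPart_congr hL hA hB hAfin ?_⟩
      exact ((ENNReal.toReal_eq_toReal_iff' hBfin hAfin).1 hBA).symm
    · exact ⟨0, fun A h1 h2 h3 => absurd ⟨A, h1, h2, h3⟩ hx⟩
  choose f hf using hex
  exact ⟨f, fun A hA hAfin => hf _ A hA hAfin rfl⟩

theorem isAdditiveAlong (h : IsHahnPair μ m e Q) (hL : SatisfiesL μ ν) {f : ℝ → ℝ}
    (hf : ∀ A, MeasurableSet A → m A ≠ ∞ → f (m.real A) = signedPart ν e Q A) :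
    IsAdditiveAlong m f := by
  intro A hA hd hfin
  have hU : MeasurableSet (⋃ i, A i) := .iUnion hA
  have hAfin : ∀ i, m (A i) ≠ ∞ := fun i =>
    ne_top_of_le_ne_top hfin (measure_mono (subset_iUnion A i))
  have key : ∀ D, MeasurableSet D →
      HasSum (fun i => (ν (A i ∩ D)).toReal) (ν ((⋃ i, A i) ∩ D)).toReal := by
    intro D hD
    refine hasSum_toReal ?_ (fun i => h.finite_right hL ((hA i).inter hD)
      (ne_top_of_le_ne_top (hAfin i) (measure_mono inter_subset_left)))
      (h.finite_right hL (hU.inter hD)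
      (ne_top_of_le_ne_top hfin (measure_mono inter_subset_left)))
    rw [iUnion_inter]
    exact ν.m_iUnion (fun i => (hA i).inter hD)
      fun i j hij => (hd hij).mono inter_subset_left inter_subset_left
  rw [hf _ hU hfin]
  simp only [hf _ (hA _) (hAfin _), signedPart]
  exact ((key _ h.meas.compl).sub (key _ h.meas)).mul_left e

theorem eq_zero_of_null (h : IsHahnPair μ m e Q) (hL : SatisfiesL μ ν) {A : Set Ω}
    (hA : MeasurableSet A) (h0 : m A = 0) : μ A = 0 ∧ ν A = 0 := by
  have h1 : μ A = 0 := by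
    rw [h.add_inter μ hA, h.compl _ (hA.inter h.meas.compl) inter_subset_right,
      h.self _ (hA.inter h.meas) inter_subset_right, measure_mono_null inter_subset_left h0,
      measure_mono_null inter_subset_left h0]
    simp
  refine ⟨h1, ?_⟩
  have h2 := hL A ∅ hA .empty (by rw [h1, μ.empty]) (by simp [h1]) (by simp [h1])
  rw [h2.1, ν.empty]

/-- On an atom, the pair `(μ, ν)` agrees with `(m, signedPart ν)` up to a common sign. -/
theorem exists_sign_of_atom (h : IsHahnPair μ m e Q) (hL : SatisfiesL μ ν) {A : Set Ω}
    (hA : IsAtomOfMeasure m A) (hAfin : m A ≠ ∞) :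
    ∃ s : ℝ, |s| = 1 ∧ μ A = ((s * m.real A : ℝ) : EReal) ∧
      ν A = ((s * signedPart ν e Q A : ℝ) : EReal) := by
  have hr := (coe_measureReal hAfin).symm
  have he : |e| = 1 := by rcases h.sign with rfl | rfl <;> simp
  have hee : e * e = 1 := by rcases h.sign with rfl | rfl <;> simp
  have hνA := h.finite_right hL hA.1 hAfin
  have hν := EReal.coe_toReal hνA.1 hνA.2
  have hμ := h.add_inter μ hA.1
  have hνs := h.add_inter ν hA.1
  have hm : m (A ∩ Q) + m (A ∩ Qᶜ) = m A := measure_inter_add_sdiff A h.meas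
  rcases hA.2.2 (A ∩ Q) (hA.1.inter h.meas) inter_subset_left with h0 | h0
  · obtain ⟨z1, z2⟩ := h.eq_zero_of_null hL (hA.1.inter h.meas) h0
    rw [z1, add_zero, h.compl _ (hA.1.inter h.meas.compl) inter_subset_right] at hμ
    rw [z2, add_zero] at hνs
    rw [h0, zero_add] at hm
    refine ⟨e, he, ?_, ?_⟩
    · rw [hμ, hm, hr, EReal.coe_mul]
    · rw [signedPart, ← hνs, z2, EReal.toReal_zero, sub_zero, ← mul_assoc, hee, one_mul, hν]
  · rw [sdiff_self_inter] at h0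
    obtain ⟨z1, z2⟩ := h.eq_zero_of_null hL (hA.1.inter h.meas.compl) h0
    rw [z1, zero_add, h.self _ (hA.1.inter h.meas) inter_subset_right] at hμ
    rw [z2, zero_add] at hνs
    rw [show m (A ∩ Qᶜ) = 0 from h0, add_zero] at hm
    refine ⟨-e, by rwa [abs_neg], ?_, ?_⟩
    · rw [hμ, hm, hr, EReal.coe_mul]
    · rw [signedPart, ← hνs, z2, EReal.toReal_zero, zero_sub, ← mul_assoc, mul_neg, neg_mul,
        neg_mul, hee, neg_neg, one_mul, hν]

theorem eq_mul_of_finite (h : IsHahnPair μ m e Q) (hL : SatisfiesL μ ν) {α : ℝ}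
    (hα : ∀ A, MeasurableSet A → m A ≠ ∞ → signedPart ν e Q A = α * m.real A) {A : Set Ω}
    (hA : MeasurableSet A) (hAfin : m A ≠ ∞) : ν A = (α : EReal) * μ A := by
  have hee : e * e = 1 := by rcases h.sign with rfl | rfl <;> simp
  have hA1 := hA.inter h.meas.compl
  have hA2 := hA.inter h.meas
  have m1 : m (A ∩ Qᶜ) ≠ ∞ := ne_top_of_le_ne_top hAfin (measure_mono inter_subset_left)
  have m2 : m (A ∩ Q) ≠ ∞ := ne_top_of_le_ne_top hAfin (measure_mono inter_subset_left)
  have f1 := h.finite_right hL hA1 m1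
  have f2 := h.finite_right hL hA2 m2
  have e1 := hα _ hA1 m1
  have e2 := hα _ hA2 m2
  rw [signedPart, inter_assoc, inter_assoc, inter_self, compl_inter_self, inter_empty, ν.empty,
    EReal.toReal_zero, sub_zero] at e1
  rw [signedPart, inter_assoc, inter_assoc, inter_self, inter_compl_self, inter_empty, ν.empty,
    EReal.toReal_zero, zero_sub] at e2
  have g1 : (ν (A ∩ Qᶜ)).toReal = α * (e * m.real (A ∩ Qᶜ)) := by
    linear_combination e * e1 - (ν (A ∩ Qᶜ)).toReal * hee
  have g2 : (ν (A ∩ Q)).toReal = α * (-e * m.real (A ∩ Q)) := by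
    linear_combination -e * e2 - (ν (A ∩ Q)).toReal * hee
  rw [h.add_inter ν hA, h.add_inter μ hA, h.compl _ hA1 inter_subset_right,
    h.self _ hA2 inter_subset_right, ← EReal.coe_toReal f1.1 f1.2, ← EReal.coe_toReal f2.1 f2.2,
    g1, g2, ← coe_measureReal m1, ← coe_measureReal m2]
  simp only [← EReal.coe_mul, ← EReal.coe_add]
  congr 1
  ring

end IsHahnPair

theorem eq_mul_of_sigmaFinite {m : Measure Ω} [SigmaFinite m] {α : ℝ}
    (hfin : ∀ A, MeasurableSet A → m A ≠ ∞ → μ A ≠ ⊤ ∧ μ A ≠ ⊥)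
    (hα : ∀ A, MeasurableSet A → m A ≠ ∞ → ν A = (α : EReal) * μ A) {A : Set Ω}
    (hA : MeasurableSet A) : ν A = (α : EReal) * μ A := by
  set S := disjointed (spanningSets m) with hS
  have hSm : ∀ n, MeasurableSet (A ∩ S n) := fun n =>
    hA.inter (.disjointed (measurableSet_spanningSets m) n)
  have hSfin : ∀ n, m (A ∩ S n) ≠ ∞ := fun n =>
    ((measure_mono (inter_subset_right.trans (disjointed_subset _ n))).trans_lt
      (measure_spanningSets_lt_top m n)).ne
  have hsum : ∀ v : VectorMeasure Ω EReal, HasSum (fun n => v (A ∩ S n)) (v A) := by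
    intro v
    have h := v.m_iUnion (f := fun n => A ∩ S n) hSm
      fun i j hij => (disjoint_disjointed _ hij).mono inter_subset_right inter_subset_right
    rwa [← inter_iUnion, hS, iUnion_disjointed, iUnion_spanningSets, inter_univ] at h
  have h1 := hsum ν
  simp only [hα _ (hSm _) (hSfin _)] at h1
  -- Multiplication by `0` is not continuous at `±∞`, so this case is settled by a series of zeros.
  by_cases h0 : α = 0
  · subst h0
    simp only [EReal.coe_zero, zero_mul] at h1 ⊢
    exact h1.unique hasSum_zero
  · exact h1.unique (hasSum_coe_mul (hsum μ) (fun n => hfin _ (hSm n) (hSfin n)) h0)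

end LevelSets

/-! ### The theorem. -/

theorem theorem3p5 {Ω : Type*} [MeasurableSpace Ω] (μ ν : MeasureTheory.VectorMeasure Ω EReal)
    (hμ : LevelSets.IsSigmaFiniteSignedMeasure μ)
    (hν : LevelSets.IsSigmaFiniteSignedMeasure ν)
    (hrange : (LevelSets.measureRange μ).OrdConnected)
    (hL : LevelSets.SatisfiesL μ ν)
    (hbound : ∃ ε M : ℝ, 0 < ε ∧ ∀ A, LevelSets.IsAtomOf μ A →
      (μ A).abs < ENNReal.ofReal ε → (ν A / μ A).abs < ENNReal.ofReal M) :
    ∃ α : ℝ, ∀ A, MeasurableSet A → ν A = (α : EReal) * μ A := by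
  obtain ⟨e, Q, h⟩ := hμ.exists_hahnPair
  obtain ⟨f, hf⟩ := h.exists_function hL
  obtain ⟨ε, M, hε, hM⟩ := hbound
  have := hμ.2
  obtain ⟨α, hα⟩ := (h.isAdditiveAlong hL hf).exists_linear (h.hasFullRange hrange)
    (ε := ENNReal.ofReal ε) (M := M) (by simpa using hε) (by
      intro A hA hAε
      have hAfin := (hAε.trans ENNReal.ofReal_lt_top).ne
      rw [hf A hA.1 hAfin]
      -- On an atom the sign `s` cancels in `ν A / μ A`, so the hypothesis on atoms of `μ` bounds
      -- the quotient of `f` on atoms of its variation.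
      obtain ⟨s, hs, hμA, hνA⟩ := h.exists_sign_of_atom hL hA hAfin
      have hpos : 0 < (LevelSets.variation μ).real A := ENNReal.toReal_pos hA.2.1 hAfin
      have h1 := hM A hA (by
        rw [hμA, EReal.abs_def, abs_mul, hs, one_mul, abs_of_pos hpos,
          MeasureTheory.measureReal_def, ENNReal.ofReal_toReal hAfin]
        exact hAε)
      rw [hνA, hμA, ← EReal.coe_div, EReal.abs_def, abs_div, abs_mul, abs_mul, hs, one_mul,
        one_mul, abs_of_pos hpos] at h1
      have h2 := (ENNReal.ofReal_lt_ofReal_iff'.1 h1).1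
      rw [div_lt_iff₀ hpos] at h2
      exact h2.le)
  refine ⟨α, fun A hA => LevelSets.eq_mul_of_sigmaFinite (m := LevelSets.variation μ)
    (fun B hB hBfin => h.finite_of_subset hB hBfin) (fun B hB hBfin => ?_) hA⟩
  exact h.eq_mul_of_finite hL (fun C hC hCfin => by rw [← hf C hC hCfin, hα C hC hCfin]) hB hBfin
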